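/- **Setup.** Let $K$ be a field and let $q,t\in K$ be nonzero and generic, in the sense that $q^at^b=1$ with $a,b\in\mathbb Z$ forces $a=b=0$ (for example, $q,t$ indeterminates and $K=\mathbb{Q}(q,t)$). Let $\mu=(\mu_1,\dots,\mu_n)\in\mathbb{Z}_{\ge0}^n$ be a composition, $|\mu|=\sum_i\mu_i$. On $K[x_1,\dots,x_n]$ let $\mathfrak s_i$ exchange $x_i$ and $x_{i+1}$ and put, for $1\le i\le n-1$, $$T_i=t-\frac{x_i-tx_{i+1}}{x_i-x_{i+1}}(1-\mathfrak s_i),\qquad T_i^{-1}=t^{-1}\Bigl(1-\frac{x_i-tx_{i+1}}{x_i-x_{i+1}}(1-\mathfrak s_i)\Bigr),$$ $(\omega h)(x_1,\dots,x_n)=h(x_2,\dots,x_n,qx_1)$, and $Y_i=T_{i-1}\cdots T_1\,\omega\,T_{n-1}^{-1}\cdots T_i^{-1}$ for $1\le i\le n$. The nonsymmetric Macdonald polynomial $f_\mu(x_1,\dots,x_n;q,t)$ is the unique polynomial in $K[x_1,\dots,x_n]$ of total degree at most $|\mu|$ in which $x^\mu=\prod_i x_i^{\mu_i}$ has coefficient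 $1$ and which satisfies, for all $1\le i\le n$, $$Y_if_\mu=q^{\mu_i}t^{\eta_i(\mu)+i-1}f_\mu,\qquad \eta_i(\mu)=-\#\{j<i:\mu_j>\mu_i\}-\#\{j>i:\mu_j\ge\mu_i\}.$$ Let $\mathrm{dg}(\mu)=\{(i,j):1\le i\le n,\ 1\le j\le\mu_i\}$ and $\widehat{\mathrm{dg}}(\mu)=\{(i,j):1\le i\le n,\ 0\le j\le\mu_i\}$. For $s=(i,j)\in\mathrm{dg}(\mu)$ put $l(s)=\mu_i-j$ and $$a(s)=\#\{k<i:\mu_k=\mu_i\}+\#\{k\ne i:j-1<\mu_k<\mu_i\}+\#\{k>i:\mu_k=j-1\}.$$ A filling $\sigma$ of shape $\mu$ assigns $\sigma_{i,j}\in\{1,\dots,n\}$ to each $(i,j)\in\widehat{\mathrm{dg}}(\mu)$, with $\sigma_{i,0}=i$ for all $i$. It is non-attacking if $\sigma_{i,j}\ne\sigma_{i',j'}$ for all $(i,j),(i',j')\in\widehat{\mathrm{dg}}(\mu)$ with $i<i'$ and ($j=j'$ or $j=j'+1$); $\mathfrak S(\mu)$ is the set of non-attacking fillings. Let $\mathcal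 D(\sigma)$ (descents) and $\mathcal A(\sigma)$ (ascents) be the sets of $(i,j)\in\mathrm{dg}(\mu)$ with $\sigma_{i,j}>\sigma_{i,j-1}$ and $\sigma_{i,j}<\sigma_{i,j-1}$, respectively. Consider squares $(i,j)\in\mathrm{dg}(\mu)$, $(i',j-1)\in\widehat{\mathrm{dg}}(\mu)$ and $(i',j)$ with $i<i'$, where $\sigma_{i',j}=\infty$ if $(i',j)\notin\mathrm{dg}(\mu)$. They form a positive ordered triple if $\sigma_{i',j}>\sigma_{i,j}>\sigma_{i',j-1}$ and a negative one if $\sigma_{i',j}<\sigma_{i,j}<\sigma_{i',j-1}$; $\Delta(\sigma)$ is the number of positive minus the number of negative ordered triples. Finally $x^\sigma=\prod_{i=1}^n\prod_{j=1}^{\mu_i}x_{\sigma_{i,j}}$. **Proposition.** The polynomial $f_\mu$ exists, is unique, and is given by $$f_\mu(x_1,\dots,x_n;q,t)=\sum_{\sigma\in\mathfrak S(\mu)}x^\sigma\,t^{\Delta(\sigma)}\prod_{s\in\mathcal D(\sigma)}\frac{1-t}{1-q^{l(s)+1}t^{a(s)+1}}\prod_{s\in\mathcal A(\sigma)}\frac{q^{l(s)+1}t^{a(s)}(1-t)}{1-q^{l(s)+1}t^{a(s)+1}}.$$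 -/

import Mathlib

noncomputable section

namespace NonsymMacdonald

/-! Compositions of length `n` are functions `μ : Fin n → ℕ`. Variables, columns of diagrams and
entries of fillings are indexed by `Fin n`, so the index `i` of the literature is `i - 1` here;
rows of diagrams are indexed by `ℕ`, the basement being row `0`. -/

section Operators

variable {K : Type*} [Field K] {n : ℕ}

/-- The transposition of the variables `x_a` and `x_b`. -/
def swapVars (a b : Fin n) : MvPolynomial (Fin n) K →ₐ[K] MvPolynomial (Fin n) K :=
  MvPolynomial.rename (Equiv.swap a b)

theorem sub_dvd_sub_swapVars (a b : Fin n) (h : MvPolynomial (Fin n) K) :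
    (MvPolynomial.X a - MvPolynomial.X b) ∣ h - swapVars a b h := by
  induction h using MvPolynomial.induction_on with
  | C c => simp [swapVars]
  | add p r hp hr =>
    have e : p + r - swapVars a b (p + r)
        = (p - swapVars a b p) + (r - swapVars a b r) := by
      rw [map_add]; ring
    rw [e]
    exact dvd_add hp hr
  | mul_X p i hp =>
    have e : p * MvPolynomial.X i - swapVars a b (p * MvPolynomial.X i)
        = (p - swapVars a b p) * MvPolynomial.X i
          + swapVars a b p * (MvPolynomial.X i - MvPolynomial.X (Equiv.swap a b i)) := by
      rw [map_mul]
      have : swapVars (K := K) a b (MvPolynomial.X i) = MvPolynomial.X (Equiv.swap a b i) := by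
        simp [swapVars]
      rw [this]; ring
    rw [e]
    refine dvd_add (hp.mul_right _) (Dvd.dvd.mul_left ?_ _)
    by_cases ha : i = a
    · subst ha; simp
    by_cases hb : i = b
    · subst hb
      rw [Equiv.swap_apply_right]
      exact ⟨-1, by ring⟩
    · rw [Equiv.swap_apply_of_ne_of_ne ha hb]; simp

/-- The quotient of `h - s h` by `x_a - x_b`, where `s` exchanges `x_a` and `x_b`. -/
def divDiffFun (a b : Fin n) (h : MvPolynomial (Fin n) K) : MvPolynomial (Fin n) K :=
  Classical.choose (sub_dvd_sub_swapVars a b h)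

theorem mul_divDiffFun (a b : Fin n) (h : MvPolynomial (Fin n) K) :
    (MvPolynomial.X a - MvPolynomial.X b) * divDiffFun a b h = h - swapVars a b h :=
  (Classical.choose_spec (sub_dvd_sub_swapVars a b h)).symm

theorem X_sub_X_ne_zero {a b : Fin n} (hab : a ≠ b) :
    (MvPolynomial.X a - MvPolynomial.X b : MvPolynomial (Fin n) K) ≠ 0 :=
  sub_ne_zero.mpr fun e => hab (MvPolynomial.X_injective e)

/-- The divided difference operator `(x_a - x_b)⁻¹ (1 - s)` for `a ≠ b`, where `s` exchanges
`x_a` and `x_b`. -/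
def divDiff (a b : Fin n) (hab : a ≠ b) : Module.End K (MvPolynomial (Fin n) K) where
  toFun := divDiffFun a b
  map_add' g h := by
    apply mul_left_cancel₀ (X_sub_X_ne_zero (K := K) hab)
    rw [mul_add, mul_divDiffFun, mul_divDiffFun, mul_divDiffFun, map_add]
    ring
  map_smul' c h := by
    apply mul_left_cancel₀ (X_sub_X_ne_zero (K := K) hab)
    rw [RingHom.id_apply, mul_smul_comm, mul_divDiffFun, mul_divDiffFun, map_smul, smul_sub]

/-- The operator `(x_k - t x_{k+1}) / (x_k - x_{k+1}) (1 - s_k)` on polynomials, for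
`0 ≤ k < n - 1` (for other `k` there is no such operator and the value is `0`). -/
def demazure (t : K) (k : ℕ) : Module.End K (MvPolynomial (Fin n) K) :=
  if h : k + 1 < n then
    LinearMap.mulLeft K
        (MvPolynomial.X ⟨k, by omega⟩ - MvPolynomial.C t * MvPolynomial.X ⟨k + 1, h⟩) *
      divDiff ⟨k, by omega⟩ ⟨k + 1, h⟩ (by simp)
  else 0

/-- The Hecke generator `T_k = t - (x_k - t x_{k+1}) / (x_k - x_{k+1}) (1 - s_k)`. -/
def heckeT (t : K) (k : ℕ) : Module.End K (MvPolynomial (Fin n) K) :=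
  t • (1 : Module.End K (MvPolynomial (Fin n) K)) - demazure t k

/-- The inverse Hecke generator
`T_k⁻¹ = t⁻¹ (1 - (x_k - t x_{k+1}) / (x_k - x_{k+1}) (1 - s_k))`. -/
def heckeTInv (t : K) (k : ℕ) : Module.End K (MvPolynomial (Fin n) K) :=
  t⁻¹ • ((1 : Module.End K (MvPolynomial (Fin n) K)) - demazure t k)

/-- The cyclic generator `ω = τ s_0 s_1 ⋯ s_{n-2}`, where `τ` is the shift `x_0 ↦ q x_0`; that is,
`(ω h)(x_0, …, x_{n-1}) = h(x_1, …, x_{n-1}, q x_0)`. -/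
def omega (q : K) : Module.End K (MvPolynomial (Fin n) K) :=
  (MvPolynomial.aeval fun i : Fin n =>
    if h : (i : ℕ) + 1 < n then (MvPolynomial.X ⟨i + 1, h⟩ : MvPolynomial (Fin n) K)
    else MvPolynomial.C q * MvPolynomial.X ⟨0, i.pos⟩).toLinearMap

/-- The Cherednik–Dunkl operator `Y_i = T_{i-1} ⋯ T_0 ω T_{n-2}⁻¹ ⋯ T_i⁻¹`, for `0 ≤ i < n`. -/
def cherednikY (q t : K) (i : Fin n) : Module.End K (MvPolynomial (Fin n) K) :=
  (((List.range i).reverse.map (heckeT t)).prod * omega q) *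
    ((List.range' i (n - 1 - i)).reverse.map (heckeTInv t)).prod

/-- `η_i(μ) = -#{j < i : μ_j > μ_i} - #{j > i : μ_j ≥ μ_i}`. -/
def eta (μ : Fin n → ℕ) (i : Fin n) : ℤ :=
  -((Finset.univ.filter fun j : Fin n => j < i ∧ μ i < μ j).card : ℤ)
    - ((Finset.univ.filter fun j : Fin n => i < j ∧ μ i ≤ μ j).card : ℤ)

/-- The eigenvalue `y_i(μ; q, t) = q^{μ_i} t^{η_i(μ) + i}` (with `i` counted from `0`). -/
def eigenvalueY (q t : K) (μ : Fin n → ℕ) (i : Fin n) : K :=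
  q ^ μ i * t ^ (eta μ i + (i : ℤ))

/-- The defining property of the nonsymmetric Macdonald polynomial `f_μ(x; q, t)`: it has total
degree at most `|μ|`, the coefficient of `x^μ` in it is `1`, and it is an eigenfunction of every
Cherednik–Dunkl operator `Y_i`, with eigenvalue `y_i(μ; q, t)`. -/
structure IsNonsymMacdonald (q t : K) (μ : Fin n → ℕ) (f : MvPolynomial (Fin n) K) : Prop where
  totalDegree_le : f.totalDegree ≤ ∑ i, μ i
  coeff_eq_one : f.coeff (Finsupp.equivFunOnFinite.symm μ) = 1
  eigen : ∀ i : Fin n, cherednikY q t i f = eigenvalueY q t μ i • f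

end Operators

section Fillings

variable {n : ℕ}

/-- The diagram of `μ`: the squares `⟨i, j⟩` (column `i`, row `j`) with `1 ≤ j ≤ μ i`. -/
def dg (μ : Fin n → ℕ) : Finset (Σ _ : Fin n, ℕ) :=
  Finset.univ.sigma fun i => Finset.Icc 1 (μ i)

/-- The extended diagram of `μ`: the squares `⟨i, j⟩` with `0 ≤ j ≤ μ i`. -/
def extDg (μ : Fin n → ℕ) : Finset (Σ _ : Fin n, ℕ) :=
  Finset.univ.sigma fun i => Finset.Icc 0 (μ i)

/-- The leg length `l(s) = μ_i - j` of a square `s = (i, j)` of the diagram. -/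
def leg (μ : Fin n → ℕ) (s : Σ _ : Fin n, ℕ) : ℕ := μ s.1 - s.2

/-- `α_{i,j}(μ) = #{k < i : μ_k = μ_i} + #{k ≠ i : j < μ_k < μ_i} + #{k > i : j = μ_k}`. -/
def alpha (μ : Fin n → ℕ) (i : Fin n) (j : ℕ) : ℕ :=
  (Finset.univ.filter fun k : Fin n => k < i ∧ μ k = μ i).card
    + (Finset.univ.filter fun k : Fin n => k ≠ i ∧ j < μ k ∧ μ k < μ i).card
    + (Finset.univ.filter fun k : Fin n => i < k ∧ j = μ k).card

/-- The arm length `a(s) = α_{i,j-1}(μ)` of a square `s = (i, j)` of the diagram (so `j ≥ 1`). -/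
def arm (μ : Fin n → ℕ) (s : Σ _ : Fin n, ℕ) : ℕ := alpha μ s.1 (s.2 - 1)

/-- Two squares of the extended diagram attack: `(i, j) ⊢ (i', j')` if `i < i'` and either `j = j'`
or `j = j' + 1`. -/
def Attacks (s s' : Σ _ : Fin n, ℕ) : Prop :=
  s.1 < s'.1 ∧ (s.2 = s'.2 ∨ s.2 = s'.2 + 1)

/-- A filling of the extended diagram of `μ`: `σ i j` is the entry of the square `(i, j)`,
`0 ≤ j ≤ μ i`, and the basement entries are `σ i 0 = i`. -/
abbrev Filling (μ : Fin n → ℕ) : Type :=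
  {σ : (i : Fin n) → Fin (μ i + 1) → Fin n // ∀ i, σ i 0 = i}

namespace Filling

variable {μ : Fin n → ℕ}

/-- The entry of a filling in a square, with the convention that it is `∞` outside the extended
diagram. -/
def entry (σ : Filling μ) (s : Σ _ : Fin n, ℕ) : WithTop (Fin n) :=
  if h : s.2 < μ s.1 + 1 then ((σ.1 s.1 ⟨s.2, h⟩ : Fin n) : WithTop (Fin n)) else ⊤

/-- Attacking squares have different entries. -/
def NonAttacking (σ : Filling μ) : Prop :=
  ∀ s ∈ extDg μ, ∀ s' ∈ extDg μ, Attacks s s' → σ.entry s ≠ σ.entry s'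

/-- The descents of a filling. -/
def descents (σ : Filling μ) : Finset (Σ _ : Fin n, ℕ) :=
  (dg μ).filter fun s => σ.entry ⟨s.1, s.2 - 1⟩ < σ.entry s

/-- The ascents of a filling. -/
def ascents (σ : Filling μ) : Finset (Σ _ : Fin n, ℕ) :=
  (dg μ).filter fun s => σ.entry s < σ.entry ⟨s.1, s.2 - 1⟩

/-- The candidates for ordered triples, that is, the triples of squares `(i, j)` in the diagram,
`(i', j - 1)` in the extended diagram, and `(i', j)`, where `i < i'`; they are recorded as
`((i, j), i')`. -/
def triples (μ : Fin n → ℕ) : Finset ((Σ _ : Fin n, ℕ) × Fin n) :=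
  (dg μ ×ˢ Finset.univ).filter fun p => p.1.1 < p.2 ∧ ⟨p.2, p.1.2 - 1⟩ ∈ extDg μ

/-- The number of positive ordered triples: `σ_{i',j} > σ_{i,j} > σ_{i',j-1}`. -/
def ordPos (σ : Filling μ) : ℕ :=
  ((triples μ).filter fun p =>
    σ.entry p.1 < σ.entry ⟨p.2, p.1.2⟩ ∧ σ.entry ⟨p.2, p.1.2 - 1⟩ < σ.entry p.1).card

/-- The number of negative ordered triples: `σ_{i',j} < σ_{i,j} < σ_{i',j-1}`. -/
def ordNeg (σ : Filling μ) : ℕ :=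
  ((triples μ).filter fun p =>
    σ.entry ⟨p.2, p.1.2⟩ < σ.entry p.1 ∧ σ.entry p.1 < σ.entry ⟨p.2, p.1.2 - 1⟩).card

/-- `Δ(σ) = ord₊(σ) - ord₋(σ)`. -/
def delta (σ : Filling μ) : ℤ := (σ.ordPos : ℤ) - (σ.ordNeg : ℤ)

/-- The monomial `x^σ = ∏_i ∏_{j=1}^{μ_i} x_{σ_{i,j}}`. -/
def xpow (K : Type*) [Field K] (σ : Filling μ) : MvPolynomial (Fin n) K :=
  ∏ i : Fin n, ∏ j : Fin (μ i), MvPolynomial.X (σ.1 i j.succ)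

end Filling

open Classical in
/-- The set `𝔖(μ)` of non-attacking fillings. -/
def nonAttackingFillings (μ : Fin n → ℕ) : Finset (Filling μ) :=
  Finset.univ.filter fun σ => σ.NonAttacking

end Fillings

end NonsymMacdonald

end

noncomputable section

namespace NonsymMacdonald

open MvPolynomial

section Hecke

variable {K : Type*} [Field K] {n : ℕ}

theorem sub_mul_demazure (t : K) {k : ℕ} (hk : k + 1 < n) (f : MvPolynomial (Fin n) K) :
    (X ⟨k, by omega⟩ - X ⟨k + 1, hk⟩) * demazure t k f =
      (X ⟨k, by omega⟩ - C t * X ⟨k + 1, hk⟩) *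
        (f - swapVars ⟨k, by omega⟩ ⟨k + 1, hk⟩ f) := by
  rw [demazure, dif_pos hk, Module.End.mul_apply, LinearMap.mulLeft_apply, ← mul_divDiffFun]
  simp only [divDiff, LinearMap.coe_mk, AddHom.coe_mk]
  ring

theorem swapVars_X_left (a b : Fin n) : swapVars (K := K) a b (X a) = X b := by
  simp [swapVars]

theorem swapVars_X_right (a b : Fin n) : swapVars (K := K) a b (X b) = X a := by
  simp [swapVars]

theorem swapVars_C (a b : Fin n) (c : K) : swapVars a b (C c) = C c := by
  simp [swapVars]

theorem swapVars_swapVars (a b : Fin n) (f : MvPolynomial (Fin n) K) :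
    swapVars a b (swapVars a b f) = f := by
  rw [swapVars, rename_rename]
  have : (Equiv.swap a b : Fin n → Fin n) ∘ Equiv.swap a b = id := by
    funext x; simp
  rw [this, rename_id_apply]

theorem X_sub_X_succ_ne_zero {k : ℕ} (hk : k + 1 < n) :
    (X ⟨k, by omega⟩ - X ⟨k + 1, hk⟩ : MvPolynomial (Fin n) K) ≠ 0 :=
  X_sub_X_ne_zero (by simp)

theorem sub_mul_heckeT (t : K) {k : ℕ} (hk : k + 1 < n) (f : MvPolynomial (Fin n) K) :
    (X ⟨k, by omega⟩ - X ⟨k + 1, hk⟩) * heckeT t k f =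
      (X ⟨k, by omega⟩ - X ⟨k + 1, hk⟩) * (C t * f) -
      (X ⟨k, by omega⟩ - C t * X ⟨k + 1, hk⟩) *
        (f - swapVars ⟨k, by omega⟩ ⟨k + 1, hk⟩ f) := by
  rw [← sub_mul_demazure, heckeT, LinearMap.sub_apply, LinearMap.smul_apply,
    Module.End.one_apply, smul_eq_C_mul, mul_sub]

theorem heckeT_mul_of_swapVars_eq (t : K) {k : ℕ} (hk : k + 1 < n)
    {g : MvPolynomial (Fin n) K} (hg : swapVars ⟨k, by omega⟩ ⟨k + 1, hk⟩ g = g)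
    (f : MvPolynomial (Fin n) K) : heckeT t k (g * f) = g * heckeT t k f := by
  apply mul_left_cancel₀ (X_sub_X_succ_ne_zero hk)
  rw [sub_mul_heckeT, map_mul, hg]
  linear_combination (-g) * sub_mul_heckeT t hk f

theorem heckeT_X_left_mul (t : K) {k : ℕ} (hk : k + 1 < n) (f : MvPolynomial (Fin n) K) :
    heckeT t k (X ⟨k, by omega⟩ * f) =
      X ⟨k + 1, hk⟩ * heckeT t k f + C (t - 1) * (X ⟨k, by omega⟩ * f) := by
  apply mul_left_cancel₀ (X_sub_X_succ_ne_zero hk)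
  rw [sub_mul_heckeT, map_mul, swapVars_X_left, map_sub, map_one]
  linear_combination (-X ⟨k + 1, hk⟩) * sub_mul_heckeT t hk f

theorem heckeT_X_right_mul (t : K) {k : ℕ} (hk : k + 1 < n) (f : MvPolynomial (Fin n) K) :
    heckeT t k (X ⟨k + 1, hk⟩ * f) =
      X ⟨k, by omega⟩ * (heckeT t k f - C (t - 1) * f) := by
  apply mul_left_cancel₀ (X_sub_X_succ_ne_zero hk)
  rw [sub_mul_heckeT, map_mul, swapVars_X_right, map_sub, map_one]
  linear_combination (-X ⟨k, by omega⟩) * sub_mul_heckeT t hk f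

theorem heckeT_one (t : K) {k : ℕ} (hk : k + 1 < n) :
    heckeT t k (1 : MvPolynomial (Fin n) K) = C t := by
  apply mul_left_cancel₀ (X_sub_X_succ_ne_zero hk)
  rw [sub_mul_heckeT, map_one]
  ring

theorem demazure_demazure (t : K) {k : ℕ} (hk : k + 1 < n) (f : MvPolynomial (Fin n) K) :
    demazure t k (demazure t k f) = C (1 + t) * demazure t k f := by
  have hX := X_sub_X_succ_ne_zero (K := K) hk
  apply mul_left_cancel₀ hX
  apply mul_left_cancel₀ hX
  have h1 := sub_mul_demazure t hk f
  have h2 := congrArg (swapVars ⟨k, by omega⟩ ⟨k + 1, hk⟩) h1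
  simp only [map_mul, map_sub, swapVars_X_left, swapVars_X_right, swapVars_C,
    swapVars_swapVars] at h2
  rw [sub_mul_demazure, map_add, map_one]
  linear_combination ((X ⟨k, by omega⟩ - C t * X ⟨k + 1, hk⟩) - (1 + C t) *
    (X ⟨k, by omega⟩ - X ⟨k + 1, hk⟩)) * h1 + (X ⟨k, by omega⟩ - C t * X ⟨k + 1, hk⟩) * h2

theorem heckeT_heckeT (t : K) {k : ℕ} (hk : k + 1 < n) (f : MvPolynomial (Fin n) K) :
    heckeT t k (heckeT t k f) = C (t - 1) * heckeT t k f + C t * f := by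
  simp only [heckeT, LinearMap.sub_apply, LinearMap.smul_apply, Module.End.one_apply, map_sub,
    map_smul, demazure_demazure t hk]
  simp only [smul_eq_C_mul, map_add, map_one]
  ring

theorem heckeTInv_heckeT {t : K} (ht : t ≠ 0) {k : ℕ} (hk : k + 1 < n)
    (f : MvPolynomial (Fin n) K) : heckeTInv t k (heckeT t k f) = f := by
  have h : heckeTInv t k (heckeT t k f) = C t⁻¹ * (C t * f) := by
    simp only [heckeT, heckeTInv, LinearMap.sub_apply, LinearMap.smul_apply,
      Module.End.one_apply, map_sub, map_smul, demazure_demazure t hk]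
    simp only [smul_eq_C_mul, map_add, map_one]
    ring
  rw [h, ← mul_assoc, ← C_mul, inv_mul_cancel₀ ht, C_1, one_mul]

end Hecke

section Words

variable {n : ℕ}

/-- A row of a filling: the letters in the columns, with `⊤` in the columns that do not reach the
row. -/
abbrev Word (n : ℕ) : Type := Fin n → WithTop (Fin n)

/-- The word obtained by applying a permutation to the letters. -/
def relabel (e : Equiv.Perm (Fin n)) (w : Word n) : Word n := fun c => WithTop.map e (w c)

/-- No letter occurs twice in the word. -/
def WordInj (w : Word n) : Prop := ∀ c d, w c = w d → w c ≠ ⊤ → c = d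

open Classical in
/-- The column in which a letter occurs in a word. -/
def pos (w : Word n) (u : Fin n) : Option (Fin n) :=
  if h : ∃ c, w c = u then some h.choose else none

theorem pos_eq_some {w : Word n} (hw : WordInj w) {u c : Fin n} :
    pos w u = some c ↔ w c = u := by
  unfold pos
  split_ifs with h
  · rw [Option.some_inj]
    constructor
    · rintro rfl
      exact h.choose_spec
    · intro hc
      exact hw _ _ (h.choose_spec.trans hc.symm) (by rw [h.choose_spec]; exact WithTop.coe_ne_top)
  · simp only [false_iff]
    exact fun hc => h ⟨c, hc⟩

theorem relabel_eq_coe {e : Equiv.Perm (Fin n)} {w : Word n} {c u : Fin n} :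
    relabel e w c = (e u : Fin n) ↔ w c = u := by
  unfold relabel
  cases w c <;> simp

theorem relabel_eq_top {e : Equiv.Perm (Fin n)} {w : Word n} {c : Fin n} :
    relabel e w c = ⊤ ↔ w c = ⊤ := by
  unfold relabel
  cases w c <;> simp

theorem relabel_apply_eq_iff (e : Equiv.Perm (Fin n)) {w w' : Word n} {c d : Fin n} :
    relabel e w c = relabel e w' d ↔ w c = w' d := by
  unfold relabel
  cases w c <;> cases w' d <;> simp

theorem WordInj.relabel {w : Word n} (hw : WordInj w) (e : Equiv.Perm (Fin n)) :
    WordInj (relabel e w) := fun c d h h' =>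
  hw c d ((relabel_apply_eq_iff e).1 h) fun h'' => h' (relabel_eq_top.2 h'')

theorem pos_relabel {w : Word n} (hw : WordInj w) (e : Equiv.Perm (Fin n)) (u : Fin n) :
    pos (relabel e w) (e u) = pos w u := by
  ext c
  rw [pos_eq_some (hw.relabel e), pos_eq_some hw, relabel_eq_coe]

theorem pos_swap_left {w : Word n} (hw : WordInj w) (a b : Fin n) :
    pos (relabel (Equiv.swap a b) w) a = pos w b := by
  simpa using pos_relabel hw (Equiv.swap a b) b

theorem pos_swap_right {w : Word n} (hw : WordInj w) (a b : Fin n) :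
    pos (relabel (Equiv.swap a b) w) b = pos w a := by
  simpa using pos_relabel hw (Equiv.swap a b) a

theorem relabel_swap_swap (a b : Fin n) (w : Word n) :
    relabel (Equiv.swap a b) (relabel (Equiv.swap a b) w) = w := by
  funext c
  unfold relabel
  cases w c <;> simp

theorem pos_ne_pos {w : Word n} (hw : WordInj w) {a b : Fin n} (hab : a ≠ b) {c : Fin n}
    (h : pos w a = some c) : pos w b ≠ some c := by
  rw [pos_eq_some hw] at h
  rw [Ne, pos_eq_some hw, h]
  simpa using hab

/-- Both positions are columns, and the first is to the left of the second. -/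
def PosLT : Option (Fin n) → Option (Fin n) → Prop
  | some c, some d => c < d
  | _, _ => False

open Classical in
/-- The indicator of a proposition. -/
def ind (P : Prop) : ℤ := if P then 1 else 0

theorem posLT_pos_iff {w w' : Word n} (hw : WordInj w) (hw' : WordInj w') (u v : Fin n) :
    PosLT (pos w u) (pos w' v) ↔ ∃ c d, c < d ∧ w c = u ∧ w' d = v := by
  constructor
  · intro h
    rcases h1 : pos w u with _ | c
    · rw [h1] at h; exact h.elim
    rcases h2 : pos w' v with _ | d
    · rw [h1, h2] at h; exact h.elim
    rw [h1, h2] at h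
    exact ⟨c, d, h, (pos_eq_some hw).1 h1, (pos_eq_some hw').1 h2⟩
  · rintro ⟨c, d, h, h1, h2⟩
    rw [(pos_eq_some hw).2 h1, (pos_eq_some hw').2 h2]
    exact h

open Classical in
theorem sum_ind_eq {w w' : Word n} (hw : WordInj w) (hw' : WordInj w') (u v : Fin n) :
    (∑ c, ∑ d, if c < d then ind (w c = u ∧ w' d = v) else 0) =
      ind (PosLT (pos w u) (pos w' v)) := by
  by_cases h : PosLT (pos w u) (pos w' v)
  · rw [ind, if_pos h]
    obtain ⟨c, d, hcd, h1, h2⟩ := (posLT_pos_iff hw hw' u v).1 h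
    rw [Finset.sum_eq_single c, Finset.sum_eq_single d]
    · simp [hcd, ind, h1, h2]
    · intro d' _ hd'
      have : w' d' ≠ v := fun h3 =>
        hd' (hw' _ _ (h3.trans h2.symm) (by rw [h3]; exact WithTop.coe_ne_top))
      simp [ind, this]
    · simp
    · intro c' _ hc'
      have : w c' ≠ u := fun h3 =>
        hc' (hw _ _ (h3.trans h1.symm) (by rw [h3]; exact WithTop.coe_ne_top))
      simp [ind, this]
    · simp
  · rw [ind, if_neg h]
    refine Finset.sum_eq_zero fun c _ => Finset.sum_eq_zero fun d _ => ?_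
    split_ifs with hcd
    · rw [ind, if_neg]
      exact fun h' => h ((posLT_pos_iff hw hw' u v).2 ⟨c, d, hcd, h'⟩)
    · rfl

/-- The value of a function at the common column of two positions, and `1` if there is none. -/
def meet {K : Type*} [One K] (f : Fin n → K) : Option (Fin n) → Option (Fin n) → K
  | some c, some d => if c = d then f c else 1
  | _, _ => 1

open Classical in
theorem prod_eq_meet {K : Type*} [CommMonoid K] {w w' : Word n} (hw : WordInj w)
    (hw' : WordInj w') (u v : Fin n) (f : Fin n → K) :
    (∏ c, if w c = u ∧ w' c = v then f c else 1) = meet f (pos w u) (pos w' v) := by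
  have h1 : ∀ c, w c = u ↔ pos w u = some c := fun c => (pos_eq_some hw).symm
  have h2 : ∀ c, w' c = v ↔ pos w' v = some c := fun c => (pos_eq_some hw').symm
  simp only [h1, h2]
  rcases pos w u with _ | c
  · simp [meet]
  rcases pos w' v with _ | d
  · simp [meet]
  simp only [Option.some_inj, meet]
  split_ifs with h
  · subst h
    simp
  · refine Finset.prod_eq_one fun x _ => if_neg ?_
    rintro ⟨rfl, rfl⟩
    exact h rfl

end Words

section RowWeights

variable {K : Type*} [Field K] {n : ℕ}

/-- Two consecutive rows of a non-attacking filling. -/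
def RowNA (w w' : Word n) : Prop :=
  ∀ c d, c < d → w' c ≠ ⊤ → w' c ≠ w' d ∧ w' c ≠ w d

/-- The contribution of two consecutive rows to `Δ`. -/
def rowDelta (w w' : Word n) : ℤ :=
  ∑ c, ∑ d, if c < d then ind (w' c < w' d) - ind (w' c < w d) else 0

/-- The factor of a square with entry `x` above the entry `y`. -/
def colWeight (t z : K) (y x : WithTop (Fin n)) : K :=
  if x = ⊤ then 1 else if y < x then (1 - t) / (1 - z)
  else if x < y then z / t * ((1 - t) / (1 - z)) else 1

open Classical in
/-- The weight of the row `w'` above the row `w`. -/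
def rowWeight (t : K) (z : Fin n → K) (w w' : Word n) : K :=
  if RowNA w w' then (∏ c, colWeight t (z c) (w c) (w' c)) * t ^ rowDelta w w' else 0

theorem RowNA.wordInj {w w' : Word n} (h : RowNA w w') : WordInj w' := by
  intro c d hcd hc
  rcases lt_trichotomy c d with hlt | rfl | hlt
  · exact ((h c d hlt hc).1 hcd).elim
  · rfl
  · exact ((h d c hlt (hcd ▸ hc)).1 hcd.symm).elim

variable (a b : Fin n)

/-- The order relation on letters, up to the comparison of `a` with `b`. -/
def StableLT (x y : WithTop (Fin n)) : Prop := x < y ∧ ¬(x = a ∧ y = b)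

variable {a b}

theorem ind_lt_eq (hab : (b : ℕ) = a + 1) (x y : WithTop (Fin n)) :
    ind (x < y) = ind (StableLT a b x y) + ind (x = a ∧ y = b) := by
  have h : (a : WithTop (Fin n)) < b := by
    rw [WithTop.coe_lt_coe, Fin.lt_def]; omega
  unfold ind StableLT
  by_cases h1 : x = a ∧ y = b
  · obtain ⟨rfl, rfl⟩ := h1
    simp [h]
  · simp [h1]

theorem stableLT_swap_left (hab : (b : ℕ) = a + 1) (x y : WithTop (Fin n)) :
    StableLT a b (WithTop.map (Equiv.swap a b) x) y ↔ StableLT a b x y := by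
  induction x with
  | top => simp
  | coe x =>
    induction y with
    | top => simp [StableLT]
    | coe y =>
      simp only [StableLT, WithTop.map_coe, WithTop.coe_lt_coe, WithTop.coe_inj,
        Equiv.swap_apply_def, Fin.lt_def, Fin.ext_iff]
      split_ifs <;> omega

theorem stableLT_swap_right (hab : (b : ℕ) = a + 1) (x y : WithTop (Fin n)) :
    StableLT a b x (WithTop.map (Equiv.swap a b) y) ↔ StableLT a b x y := by
  induction y with
  | top => simp
  | coe y =>
    induction x with
    | top => simp [StableLT]
    | coe x =>
      simp only [StableLT, WithTop.map_coe, WithTop.coe_lt_coe, WithTop.coe_inj,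
        Equiv.swap_apply_def, Fin.lt_def, Fin.ext_iff]
      split_ifs <;> omega

variable (a b) in
/-- The part of `rowDelta` that does not change when `a` and `b` are exchanged in one row. -/
def stableDelta (w w' : Word n) : ℤ :=
  ∑ c, ∑ d, if c < d then ind (StableLT a b (w' c) (w' d)) - ind (StableLT a b (w' c) (w d)) else 0

theorem rowDelta_eq (hab : (b : ℕ) = a + 1) {w w' : Word n} (hw : WordInj w) (hw' : WordInj w') :
    rowDelta w w' = stableDelta a b w w' +
      (ind (PosLT (pos w' a) (pos w' b)) - ind (PosLT (pos w' a) (pos w b))) := by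
  rw [← sum_ind_eq hw' hw', ← sum_ind_eq hw' hw]
  simp only [rowDelta, stableDelta, ← Finset.sum_add_distrib, ← Finset.sum_sub_distrib]
  refine Finset.sum_congr rfl fun c _ => Finset.sum_congr rfl fun d _ => ?_
  split_ifs
  · rw [ind_lt_eq hab, ind_lt_eq hab]
    ring
  · rfl

variable (a b) in
open Classical in
/-- The part of `colWeight` that does not change when `a` and `b` are exchanged in one row. -/
def stableCol (t z : K) (y x : WithTop (Fin n)) : K :=
  if (x = a ∨ x = b) ∧ (y = a ∨ y = b) then 1 else colWeight t z y x

open Classical in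
theorem colWeight_eq (hab : (b : ℕ) = a + 1) (t z : K) (y x : WithTop (Fin n)) :
    colWeight t z y x = stableCol a b t z y x *
      ((if x = b ∧ y = a then (1 - t) / (1 - z) else 1) *
        (if x = a ∧ y = b then z / t * ((1 - t) / (1 - z)) else 1)) := by
  have h : (a : WithTop (Fin n)) < b := by
    rw [WithTop.coe_lt_coe, Fin.lt_def]; omega
  have h2 := h.ne
  have h3 := h.ne'
  have h4 := h.le.not_gt
  unfold stableCol
  by_cases hxa : x = a
  · subst hxa
    by_cases hya : y = a
    · subst hya; simp [colWeight, h2]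
    by_cases hyb : y = b
    · subst hyb; simp [colWeight, h, h2, h3, h4]
    simp [hya, hyb]
  by_cases hxb : x = b
  · subst hxb
    by_cases hya : y = a
    · subst hya; simp [colWeight, h, h2, h3]
    by_cases hyb : y = b
    · subst hyb; simp [colWeight, h3]
    simp [hya, hyb]
  simp [hxa, hxb]

theorem map_swap_eq_or (x : WithTop (Fin n)) :
    (WithTop.map (Equiv.swap a b) x = a ∨ WithTop.map (Equiv.swap a b) x = b) ↔
      (x = a ∨ x = b) := by
  induction x with
  | top => simp
  | coe x =>
    simp only [WithTop.map_coe, WithTop.coe_inj]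
    rw [Equiv.swap_apply_eq_iff, Equiv.swap_apply_eq_iff, Equiv.swap_apply_left,
      Equiv.swap_apply_right, or_comm]

theorem lt_map_swap_iff (hab : (b : ℕ) = a + 1) {x y : WithTop (Fin n)}
    (hxy : ¬((x = a ∨ x = b) ∧ (y = a ∨ y = b))) :
    (WithTop.map (Equiv.swap a b) x < y ↔ x < y) ∧
      (x < WithTop.map (Equiv.swap a b) y ↔ x < y) := by
  have key : ∀ {x y : WithTop (Fin n)}, ¬((x = a ∨ x = b) ∧ (y = a ∨ y = b)) →
      (x < y ↔ StableLT a b x y) := by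
    intro x y h
    unfold StableLT
    have : ¬(x = a ∧ y = b) := fun h' => h ⟨.inl h'.1, .inr h'.2⟩
    simp [this]
  refine ⟨?_, ?_⟩
  · rw [key hxy, key (by rwa [map_swap_eq_or]), stableLT_swap_left hab]
  · rw [key hxy, key (by rwa [map_swap_eq_or]), stableLT_swap_right hab]

theorem stableCol_swap_left (hab : (b : ℕ) = a + 1) (t z : K) (y x : WithTop (Fin n)) :
    stableCol a b t z (WithTop.map (Equiv.swap a b) y) x = stableCol a b t z y x := by
  unfold stableCol
  simp only [map_swap_eq_or]
  split_ifs with h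
  · rfl
  · simp only [colWeight, (lt_map_swap_iff hab h).2,
      (lt_map_swap_iff hab (fun h' => h h'.symm)).1]

theorem stableCol_swap_right (hab : (b : ℕ) = a + 1) (t z : K) (y x : WithTop (Fin n)) :
    stableCol a b t z y (WithTop.map (Equiv.swap a b) x) = stableCol a b t z y x := by
  unfold stableCol
  simp only [map_swap_eq_or]
  split_ifs with h
  · rfl
  · simp only [colWeight, (lt_map_swap_iff hab h).1,
      (lt_map_swap_iff hab (fun h' => h h'.symm)).2, WithTop.map_eq_top_iff]

variable (a b) in
/-- The part of `RowNA` that does not change when `a` and `b` are exchanged in one row. -/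
def StableNA (w w' : Word n) : Prop :=
  ∀ c d, c < d → w' c ≠ ⊤ → w' c ≠ w' d ∧ (¬(w' c = a ∨ w' c = b) → w' c ≠ w d)

theorem rowNA_iff {w w' : Word n} (hw : WordInj w) (hw' : WordInj w') :
    RowNA w w' ↔ StableNA a b w w' ∧
      ¬(PosLT (pos w' a) (pos w a) ∨ PosLT (pos w' b) (pos w b)) := by
  rw [posLT_pos_iff hw' hw, posLT_pos_iff hw' hw]
  constructor
  · intro h
    refine ⟨fun c d hcd hc => ⟨(h c d hcd hc).1, fun _ => (h c d hcd hc).2⟩, ?_⟩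
    rintro (⟨c, d, hcd, h1, h2⟩ | ⟨c, d, hcd, h1, h2⟩) <;>
    exact (h c d hcd (by rw [h1]; exact WithTop.coe_ne_top)).2 (h1.trans h2.symm)
  · rintro ⟨h1, h2⟩ c d hcd hc
    refine ⟨(h1 c d hcd hc).1, fun h3 => ?_⟩
    by_cases h4 : w' c = a ∨ w' c = b
    · rcases h4 with h4 | h4
      · exact h2 (.inl ⟨c, d, hcd, h4, h3.symm.trans h4⟩)
      · exact h2 (.inr ⟨c, d, hcd, h4, h3.symm.trans h4⟩)
    · exact (h1 c d hcd hc).2 h4 h3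

theorem relabel_swap_ab (w : Word n) (c : Fin n) :
    (relabel (Equiv.swap a b) w c = a ∨ relabel (Equiv.swap a b) w c = b) ↔
      (w c = a ∨ w c = b) := map_swap_eq_or _

theorem relabel_swap_of_not {w : Word n} {c : Fin n} (h : ¬(w c = a ∨ w c = b)) :
    relabel (Equiv.swap a b) w c = w c := by
  unfold relabel
  cases hx : w c with
  | top => rfl
  | coe x =>
    rw [hx] at h
    simp only [WithTop.coe_inj, not_or] at h
    rw [WithTop.map_coe, Equiv.swap_apply_of_ne_of_ne h.1 h.2]

theorem stableNA_swap_right (w w' : Word n) :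
    StableNA a b w (relabel (Equiv.swap a b) w') ↔ StableNA a b w w' := by
  unfold StableNA
  refine forall_congr' fun c => forall_congr' fun d => imp_congr_right fun _ => ?_
  rw [Ne, relabel_eq_top]
  refine imp_congr_right fun _ => ?_
  rw [Ne, Ne, relabel_apply_eq_iff, relabel_swap_ab]
  refine and_congr_right fun _ => imp_congr_right fun h => ?_
  rw [relabel_swap_of_not h]

theorem stableNA_swap_left (w w' : Word n) :
    StableNA a b (relabel (Equiv.swap a b) w) w' ↔ StableNA a b w w' := by
  unfold StableNA
  refine forall_congr' fun c => forall_congr' fun d => imp_congr_right fun _ =>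
    imp_congr_right fun _ => and_congr_right fun _ => imp_congr_right fun h => ?_
  by_cases hd : w d = a ∨ w d = b
  · have h1 : w' c ≠ w d := fun e => h (e ▸ hd)
    have h2 : w' c ≠ relabel (Equiv.swap a b) w d := fun e =>
      h (e ▸ (relabel_swap_ab w d).2 hd)
    simp [h1, h2]
  · rw [relabel_swap_of_not hd]

variable (a b) in
open Classical in
/-- The part of `rowWeight` that does not change when `a` and `b` are exchanged in one row. -/
def stableWeight (t : K) (z : Fin n → K) (w w' : Word n) : K :=
  if StableNA a b w w' then
    (∏ c, stableCol a b t (z c) (w c) (w' c)) * t ^ stableDelta a b w w' else 0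

open Classical in
theorem stableWeight_swap_left (hab : (b : ℕ) = a + 1) (t : K) (z : Fin n → K) (w w' : Word n) :
    stableWeight a b t z (relabel (Equiv.swap a b) w) w' = stableWeight a b t z w w' := by
  unfold stableWeight stableDelta
  refine if_congr (stableNA_swap_left w w') ?_ rfl
  simp only [relabel, stableCol_swap_left hab, stableLT_swap_right hab]

open Classical in
theorem stableWeight_swap_right (hab : (b : ℕ) = a + 1) (t : K) (z : Fin n → K) (w w' : Word n) :
    stableWeight a b t z w (relabel (Equiv.swap a b) w') = stableWeight a b t z w w' := by
  unfold stableWeight stableDelta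
  refine if_congr (stableNA_swap_right w w') ?_ rfl
  simp only [relabel, stableCol_swap_right hab, stableLT_swap_right hab, stableLT_swap_left hab]

open Classical in
/-- The part of `rowWeight` that depends on the positions `p`, `p'` of `a`, `b` in the lower row and
on their positions `r`, `r'` in the upper row. -/
def localWeight (t : K) (z : Fin n → K) (r r' p p' : Option (Fin n)) : K :=
  if PosLT r p ∨ PosLT r' p' then 0 else
    meet (fun c => (1 - t) / (1 - z c)) r' p *
      meet (fun c => z c / t * ((1 - t) / (1 - z c))) r p' *
      t ^ (ind (PosLT r r') - ind (PosLT r p'))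

theorem rowWeight_eq (hab : (b : ℕ) = a + 1) {t : K} (ht : t ≠ 0) (z : Fin n → K) {w w' : Word n}
    (hw : WordInj w) (hw' : WordInj w') :
    rowWeight t z w w' = stableWeight a b t z w w' *
      localWeight t z (pos w' a) (pos w' b) (pos w a) (pos w b) := by
  classical
  unfold rowWeight stableWeight localWeight
  rw [← prod_eq_meet hw' hw, ← prod_eq_meet hw' hw, rowDelta_eq hab hw hw', zpow_add₀ ht,
    rowNA_iff (a := a) (b := b) hw hw']
  simp only [colWeight_eq hab, Finset.prod_mul_distrib]
  by_cases h1 : StableNA a b w w'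
  · by_cases h2 : PosLT (pos w' a) (pos w a) ∨ PosLT (pos w' b) (pos w b)
    · simp [h2]
    · rw [if_pos ⟨h1, h2⟩, if_pos h1, if_neg h2]
      ring
  · simp [h1]

end RowWeights

section Exchange

variable {K : Type*} [Field K] {n : ℕ}

/-- The coefficient of `x^w F_w` in `T (x^w F_w)`, in terms of the positions in `w` of the letters
involved. -/
def diagCoeff (t : K) : Option (Fin n) → Option (Fin n) → K
  | none, none => t
  | some _, none => t - 1
  | none, some _ => 0
  | some r, some r' => if r' < r then 0 else t - 1

/-- The coefficient of `x^{sw} F_{sw}` in `T (x^w F_w)`, in terms of the positions in `w` of the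
letters involved. -/
def swapCoeff (t : K) : Option (Fin n) → Option (Fin n) → K
  | none, none => 0
  | some _, none => t
  | none, some _ => 1
  | some r, some r' => if r' < r then t else 1

/-- The condition on the positions of `a` and `b` under which `T` exchanges them. -/
def PosGood : Option (Fin n) → Option (Fin n) → Prop
  | _, none => True
  | none, some _ => False
  | some p, some p' => p' < p

theorem localWeight_none_none {t : K} (z : Fin n → K) (p p' : Option (Fin n)) :
    localWeight t z none none p p' = 1 := by
  cases p <;> cases p' <;> simp [localWeight, PosLT, meet, ind]

open Classical in
theorem localWeight_some_none {t : K} (z : Fin n → K) (r : Fin n) (p p' : Option (Fin n)) :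
    localWeight t z (some r) none p p' = if PosLT (some r) p then 0 else
      meet (fun c => z c / t * ((1 - t) / (1 - z c))) (some r) p' *
      t ^ (- ind (PosLT (some r) p')) := by
  cases p <;> cases p' <;> simp [localWeight, PosLT, meet, ind]

open Classical in
theorem localWeight_none_some {t : K} (z : Fin n → K) (r : Fin n) (p p' : Option (Fin n)) :
    localWeight t z none (some r) p p' = if PosLT (some r) p' then 0 else
      meet (fun c => (1 - t) / (1 - z c)) (some r) p := by
  cases p <;> cases p' <;> simp [localWeight, PosLT, meet, ind]
  congr

theorem localWeight_exchange_single {t : K} (ht : t ≠ 0) {z : Fin n → K} (hz : ∀ c, z c ≠ 1)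
    {p p' : Option (Fin n)} (hp : PosGood p p') (r : Fin n) :
    localWeight t z (some r) none p p' * (t - 1) + localWeight t z none (some r) p p' =
      t * localWeight t z (some r) none p' p := by
  have hz' : ∀ c, 1 - z c ≠ 0 := fun c => sub_ne_zero.2 (hz c).symm
  rw [localWeight_some_none, localWeight_some_none, localWeight_none_some]
  rcases p with _ | p <;> rcases p' with _ | p'
  · simp [PosLT, meet, ind]
  · exact hp.elim
  · rcases lt_trichotomy r p with h | rfl | h
    · simp [PosLT, meet, ind, h, h.ne, ht]
    · simp only [PosLT, meet, ind, lt_self_iff_false, ↓reduceIte, neg_zero, zpow_zero]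
      field_simp [hz' r]
      ring
    · simp [PosLT, meet, ind, h.not_gt, h.ne']
  · have hp : p' < p := hp
    rcases lt_trichotomy r p with h | rfl | h
    · rcases lt_trichotomy r p' with h' | rfl | h'
      · simp [PosLT, h, h']
      · simp [PosLT, meet, ind, h, h.ne, ht]
      · simp [PosLT, meet, ind, h, h.ne, h'.not_gt, ht]
    · simp only [PosLT, meet, ind, hp.not_gt, hp.ne', lt_self_iff_false, ↓reduceIte,
        neg_zero, zpow_zero]
      field_simp [hz' r]
      ring
    · have h' := hp.trans h
      simp [PosLT, meet, ind, h.not_gt, h.ne', h'.not_gt, h'.ne']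

theorem localWeight_single_comm {t : K} {z : Fin n → K} {p p' : Option (Fin n)}
    (hp : PosGood p p') (r : Fin n) :
    localWeight t z (some r) none p p' = localWeight t z none (some r) p' p := by
  rw [localWeight_some_none, localWeight_none_some]
  rcases p with _ | p <;> rcases p' with _ | p'
  · simp [PosLT, meet, ind]
  · exact hp.elim
  · simp [PosLT, meet, ind]
    congr
  · have hp : p' < p := hp
    rcases lt_or_ge r p with h | h
    · simp [PosLT, h]
    · have h' := hp.trans_le h
      simp [PosLT, meet, ind, h.not_gt, h'.not_gt, h'.ne']

theorem localWeight_exchange_left {t : K} (z : Fin n → K)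
    {p p' : Option (Fin n)} (hp : PosGood p p') {r r' : Fin n} (hr : r' < r) :
    localWeight t z (some r') (some r) p p' = t * localWeight t z (some r) (some r') p' p := by
  rcases p with _ | p <;> rcases p' with _ | p'
  · simp [localWeight, PosLT, meet, ind, hr, hr.not_gt]
  · exact hp.elim
  · rcases lt_trichotomy r' p with h | rfl | h
    · simp [localWeight, PosLT, h]
    · simp [localWeight, PosLT, meet, ind, hr, hr.not_gt, hr.ne']
    · simp [localWeight, PosLT, meet, ind, hr, hr.not_gt, h.not_gt, (h.trans hr).ne',
        (h.trans hr).not_gt]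
  · have hp : p' < p := hp
    rcases lt_trichotomy r' p with h | rfl | h
    · simp [localWeight, PosLT, h]
    · simp [localWeight, PosLT, meet, ind, hr, hr.not_gt, hr.ne', hp.not_gt, hp.ne',
        (hp.trans hr).not_gt]
    · simp [localWeight, PosLT, meet, ind, hr, hr.not_gt, h.not_gt, (h.trans hr).ne',
        (h.trans hr).not_gt, (hp.trans h).ne', (hp.trans h).not_gt,
        (hp.trans (h.trans hr)).not_gt]

theorem localWeight_exchange_right {t : K} (ht : t ≠ 0) {z : Fin n → K} (hz : ∀ c, z c ≠ 1)
    {p p' : Option (Fin n)} (hp : PosGood p p') {r r' : Fin n} (hr : r' < r) :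
    localWeight t z (some r') (some r) p p' * (t - 1) +
        localWeight t z (some r) (some r') p p' * t =
      t * localWeight t z (some r') (some r) p' p := by
  have hz' : ∀ c, 1 - z c ≠ 0 := fun c => sub_ne_zero.2 (hz c).symm
  rcases p with _ | p <;> rcases p' with _ | p'
  · simp [localWeight, PosLT, meet, ind, hr, hr.not_gt]
    ring
  · exact hp.elim
  · rcases lt_trichotomy r' p with h | rfl | h
    · rcases lt_trichotomy r p with h' | rfl | h'
      · simp [localWeight, PosLT, h, h']
      · simp [localWeight, PosLT, meet, ind, hr, hr.not_gt, hr.ne]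
      · simp [localWeight, PosLT, meet, ind, hr, hr.not_gt, h, h.ne, h'.not_gt]
    · simp only [localWeight, PosLT, meet, ind, hr, hr.not_gt, hr.ne', lt_self_iff_false,
        ↓reduceIte, or_self, sub_zero, zpow_zero, zpow_one]
      field_simp [hz' r']
      ring
    · simp [localWeight, PosLT, meet, ind, hr, hr.not_gt, h.not_gt, h.ne', (h.trans hr).ne',
        (h.trans hr).not_gt]
      ring
  · have hp : p' < p := hp
    rcases lt_trichotomy r' p with h | rfl | h
    · rcases lt_trichotomy r p with h' | rfl | h'
      · simp [localWeight, PosLT, h, h']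
      · rcases lt_trichotomy r' p' with h'' | rfl | h''
        · simp [localWeight, PosLT, h, h'']
        · simp [localWeight, PosLT, meet, ind, hr, hr.not_gt, hr.ne, hr.ne']
        · simp [localWeight, PosLT, meet, ind, hr, hr.not_gt, hr.ne, h''.not_gt,
            hp.ne', hp.not_gt]
      · rcases lt_trichotomy r' p' with h'' | rfl | h''
        · simp [localWeight, PosLT, h, h'']
        · simp [localWeight, PosLT, meet, ind, hr, hr.not_gt, hr.ne', h, h.ne,
            h'.not_gt]
        · simp [localWeight, PosLT, meet, ind, hr, hr.not_gt, h''.not_gt,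
            h, h.ne, h'.not_gt, (hp.trans h').ne', (hp.trans h').not_gt]
    · simp only [localWeight, PosLT, meet, ind, hr, hr.not_gt, hr.ne', hp.not_gt, hp.ne',
        (hp.trans hr).ne', (hp.trans hr).not_gt, lt_self_iff_false,
        ↓reduceIte, or_self, sub_zero, zpow_zero, zpow_one]
      field_simp [hz' r']
      ring
    · simp [localWeight, PosLT, meet, ind, hr, hr.not_gt, h.not_gt, h.ne', (h.trans hr).ne',
        (h.trans hr).not_gt, (hp.trans h).ne', (hp.trans h).not_gt,
        (hp.trans (h.trans hr)).ne', (hp.trans (h.trans hr)).not_gt]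
      ring

theorem localWeight_exchange {t : K} (ht : t ≠ 0) {z : Fin n → K} (hz : ∀ c, z c ≠ 1)
    {p p' r r' : Option (Fin n)} (hp : PosGood p p') (hr : ∀ c, r = some c → r' ≠ some c) :
    localWeight t z r r' p p' * diagCoeff t r r' + localWeight t z r' r p p' * swapCoeff t r' r =
      t * localWeight t z r r' p' p := by
  rcases r with _ | r <;> rcases r' with _ | r'
  · simp [localWeight_none_none, diagCoeff, swapCoeff]
  · simpa [diagCoeff, swapCoeff, mul_comm] using
      congrArg (fun x => x * t) (localWeight_single_comm (t := t) (z := z) hp r')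
  · simpa [diagCoeff, swapCoeff] using localWeight_exchange_single ht hz hp r
  · rcases lt_trichotomy r r' with h | rfl | h
    · simpa [diagCoeff, swapCoeff, h, h.not_gt] using localWeight_exchange_right ht hz hp h
    · exact (hr r rfl rfl).elim
    · simpa [diagCoeff, swapCoeff, h, h.not_gt] using localWeight_exchange_left z hp h

end Exchange

section FillSum

variable {K : Type*} [Field K] {n : ℕ}

/-- The variable of a letter, and `1` for an empty square. -/
def letterVar (K : Type*) [Field K] (x : WithTop (Fin n)) : MvPolynomial (Fin n) K :=
  WithTop.recTopCoe 1 X x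

/-- The monomial of a word. -/
def wordMonomial (K : Type*) [Field K] (w : Word n) : MvPolynomial (Fin n) K :=
  ∏ c, letterVar K (w c)

/-- The possible words in the row `j` of a filling of shape `μ`. -/
def aliveWords (μ : Fin n → ℕ) (j : ℕ) : Finset (Word n) :=
  Finset.univ.filter fun w => ∀ c, w c = ⊤ ↔ μ c < j

/-- The generating function of the fillings of the rows `j + 1, …, j + k` above the row `j`
with entries `w`. -/
def fillSum (μ : Fin n → ℕ) (t : K) (z : ℕ → Fin n → K) :
    ℕ → ℕ → Word n → MvPolynomial (Fin n) K
  | 0, _, _ => 1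
  | k + 1, j, w => ∑ w' ∈ aliveWords μ (j + 1),
      C (rowWeight t (z j) w w') * (wordMonomial K w' * fillSum μ t z k (j + 1) w')

theorem relabel_mem_aliveWords {μ : Fin n → ℕ} {j : ℕ} {w : Word n} (e : Equiv.Perm (Fin n)) :
    relabel e w ∈ aliveWords μ j ↔ w ∈ aliveWords μ j := by
  simp [aliveWords, relabel_eq_top]

open Classical in
theorem fillSum_succ (μ : Fin n → ℕ) (t : K) (z : ℕ → Fin n → K) (k j : ℕ) (w : Word n) :
    fillSum μ t z (k + 1) j w = ∑ w' ∈ (aliveWords μ (j + 1)).filter WordInj,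
      C (rowWeight t (z j) w w') * (wordMonomial K w' * fillSum μ t z k (j + 1) w') := by
  rw [fillSum]
  refine (Finset.sum_filter_of_ne fun w' _ h => ?_).symm
  by_contra hw'
  refine h ?_
  rw [rowWeight, if_neg fun h' => hw' h'.wordInj, C_0, zero_mul]

variable {a b : Fin n}

variable (a b) in
open Classical in
/-- The part of the monomial of a word that does not involve the letters `a` and `b`. -/
def stableMonomial (K : Type*) [Field K] (w : Word n) : MvPolynomial (Fin n) K :=
  ∏ c, if w c = a ∨ w c = b then 1 else letterVar K (w c)

/-- `p` if there is a position, `1` otherwise. -/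
def ifPos (r : Option (Fin n)) (p : MvPolynomial (Fin n) K) : MvPolynomial (Fin n) K :=
  r.elim 1 fun _ => p

open Classical in
theorem prod_ite_eq_ifPos {w : Word n} (hw : WordInj w) (u : Fin n) (p : MvPolynomial (Fin n) K) :
    (∏ c, if w c = u then p else 1) = ifPos (pos w u) p := by
  have h : ∀ c, w c = u ↔ pos w u = some c := fun c => (pos_eq_some hw).symm
  simp only [h]
  rcases pos w u with _ | c
  · simp [ifPos]
  · simp [ifPos]

theorem wordMonomial_eq (hab : a ≠ b) {w : Word n} (hw : WordInj w) :
    wordMonomial K w =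
      stableMonomial a b K w * (ifPos (pos w a) (X a) * ifPos (pos w b) (X b)) := by
  classical
  rw [← prod_ite_eq_ifPos hw, ← prod_ite_eq_ifPos hw, wordMonomial, stableMonomial,
    ← Finset.prod_mul_distrib, ← Finset.prod_mul_distrib]
  refine Finset.prod_congr rfl fun c _ => ?_
  by_cases h1 : w c = a
  · simp [h1, hab, letterVar]
  by_cases h2 : w c = b
  · simp [h2, hab.symm, letterVar]
  simp [h1, h2]

theorem stableMonomial_relabel (w : Word n) :
    stableMonomial a b K (relabel (Equiv.swap a b) w) = stableMonomial a b K w := by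
  refine Finset.prod_congr rfl fun c _ => ?_
  by_cases h : w c = a ∨ w c = b
  · rw [if_pos h, if_pos ((relabel_swap_ab w c).2 h)]
  · rw [if_neg h, if_neg fun h' => h ((relabel_swap_ab w c).1 h'), relabel_swap_of_not h]

theorem swapVars_stableMonomial (w : Word n) :
    swapVars a b (stableMonomial a b K w) = stableMonomial a b K w := by
  rw [stableMonomial, map_prod]
  refine Finset.prod_congr rfl fun c _ => ?_
  split_ifs with h
  · simp
  · cases hx : w c with
    | top => simp [letterVar]
    | coe x =>
      rw [hx] at h
      simp only [WithTop.coe_inj, not_or] at h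
      simp [letterVar, swapVars, Equiv.swap_apply_of_ne_of_ne h.1 h.2]

theorem PosGood.total {r r' : Option (Fin n)} (h : ∀ c, r = some c → r' ≠ some c) :
    PosGood r r' ∨ PosGood r' r := by
  rcases r with _ | r <;> rcases r' with _ | r'
  · exact .inl trivial
  · exact .inr trivial
  · exact .inl trivial
  · rcases lt_trichotomy r r' with h' | rfl | h'
    · exact .inr h'
    · exact (h r rfl rfl).elim
    · exact .inl h'

theorem relabel_swap_of_pos_none {w : Word n} (hw : WordInj w) (ha : pos w a = none)
    (hb : pos w b = none) : relabel (Equiv.swap a b) w = w := by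
  funext c
  refine relabel_swap_of_not ?_
  rintro (h | h)
  · rw [← pos_eq_some hw, ha] at h
    cases h
  · rw [← pos_eq_some hw, hb] at h
    cases h

/-- The action of `T` on `x^w F_w`, given its action on the family `F`. -/
theorem heckeT_wordMonomial_mul {t : K} (ht : t ≠ 0) {k : ℕ} (hk : k + 1 < n)
    (ha : a = ⟨k, by omega⟩) (hb : b = ⟨k + 1, hk⟩) {F : Word n → MvPolynomial (Fin n) K}
    (hF : ∀ w, WordInj w → PosGood (pos w a) (pos w b) →
      heckeT t k (F w) = C t * F (relabel (Equiv.swap a b) w)) {w : Word n} (hw : WordInj w) :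
    heckeT t k (wordMonomial K w * F w) =
      C (diagCoeff t (pos w a) (pos w b)) * (wordMonomial K w * F w) +
      C (swapCoeff t (pos w a) (pos w b)) * (wordMonomial K (relabel (Equiv.swap a b) w) *
        F (relabel (Equiv.swap a b) w)) := by
  have hab : a ≠ b := by rw [ha, hb]; simp
  have hsw := hw.relabel (Equiv.swap a b)
  have hgood : PosGood (pos w a) (pos w b) →
      heckeT t k (F w) = C t * F (relabel (Equiv.swap a b) w) := hF w hw
  have hbad : PosGood (pos w b) (pos w a) →
      heckeT t k (F w) = C (t - 1) * F w + F (relabel (Equiv.swap a b) w) := by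
    intro h
    have h1 := hF _ hsw (by rwa [pos_swap_left hw, pos_swap_right hw])
    rw [relabel_swap_swap] at h1
    have h2 := heckeT_heckeT t hk (F (relabel (Equiv.swap a b) w))
    rw [h1, ← smul_eq_C_mul, map_smul, smul_eq_C_mul] at h2
    apply mul_left_cancel₀ (C_ne_zero.2 ht)
    rw [h2]
    simp only [smul_eq_C_mul]
    ring
  have hsym : ∀ f, heckeT t k (stableMonomial a b K w * f) =
      stableMonomial a b K w * heckeT t k f :=
    heckeT_mul_of_swapVars_eq t hk (by rw [← ha, ← hb]; exact swapVars_stableMonomial w)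
  have hXX : ∀ f : MvPolynomial (Fin n) K, heckeT t k ((X a * X b) * f) =
      (X a * X b) * heckeT t k f :=
    heckeT_mul_of_swapVars_eq t hk (by
      rw [← ha, ← hb, map_mul, swapVars_X_left, swapVars_X_right, mul_comm])
  have hXa := fun f => heckeT_X_left_mul (n := n) t hk f
  have hXb := fun f => heckeT_X_right_mul (n := n) t hk f
  rw [← ha, ← hb] at hXa hXb
  rw [wordMonomial_eq hab hw, wordMonomial_eq hab hsw, pos_swap_left hw, pos_swap_right hw,
    stableMonomial_relabel, mul_assoc, hsym]
  have hne := fun c => pos_ne_pos hw hab (c := c)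
  rcases hr : pos w a with _ | r <;> rcases hr' : pos w b with _ | r' <;> rw [hr, hr'] at hgood hbad
  · have h1 := hgood trivial
    simp only [ifPos, Option.elim, diagCoeff, swapCoeff, one_mul, C_0, zero_mul, add_zero]
    rw [h1, relabel_swap_of_pos_none hw hr hr']
    ring
  · simp only [ifPos, Option.elim, diagCoeff, swapCoeff, one_mul, mul_one, C_0, C_1, zero_mul,
      zero_add, hXb, hbad trivial]
    ring
  · simp only [ifPos, Option.elim, diagCoeff, swapCoeff, one_mul, mul_one, hXa, hgood trivial]
    ring
  · simp only [ifPos, Option.elim, diagCoeff, swapCoeff, hXX]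
    rcases lt_trichotomy r' r with h | rfl | h
    · rw [hgood h, if_pos h, if_pos h, C_0]
      ring
    · exact (hne r' hr hr').elim
    · rw [hbad h, if_neg h.not_gt, if_neg h.not_gt, C_1]
      ring

/-- The Hecke generator exchanges two adjacent letters of the bottom row, if the smaller one is to
the right of the larger one. -/
theorem heckeT_fillSum (μ : Fin n → ℕ) {t : K} (ht : t ≠ 0) {z : ℕ → Fin n → K}
    (hz : ∀ j c, z j c ≠ 1) {i : ℕ} (hi : i + 1 < n)
    (ha : a = ⟨i, by omega⟩) (hb : b = ⟨i + 1, hi⟩) (k : ℕ) :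
    ∀ (j : ℕ) (w : Word n), WordInj w → PosGood (pos w a) (pos w b) →
      heckeT t i (fillSum μ t z k j w) = C t * fillSum μ t z k j (relabel (Equiv.swap a b) w) := by
  classical
  have hab : (b : ℕ) = a + 1 := by rw [ha, hb]
  have hab' : a ≠ b := by rw [ha, hb]; simp
  induction k with
  | zero => intro j w _ _; rw [fillSum, fillSum, heckeT_one t hi, mul_one]
  | succ k ih =>
    intro j w hw hgood
    set s := Equiv.swap a b with hs
    set A := fun w' => wordMonomial K w' * fillSum μ t z k (j + 1) w' with hA
    set S := (aliveWords μ (j + 1)).filter WordInj with hS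
    have hsS : ∀ w' ∈ S, relabel s w' ∈ S := by
      intro w' hw'
      rw [hS, Finset.mem_filter] at hw' ⊢
      exact ⟨(relabel_mem_aliveWords s).2 hw'.1, hw'.2.relabel s⟩
    have hT : ∀ w' ∈ S, heckeT t i (A w') = C (diagCoeff t (pos w' a) (pos w' b)) * A w' +
        C (swapCoeff t (pos w' a) (pos w' b)) * A (relabel s w') := fun w' hw' =>
      heckeT_wordMonomial_mul ht hi ha hb (ih (j + 1)) (Finset.mem_filter.1 hw').2
    calc heckeT t i (fillSum μ t z (k + 1) j w)
        = ∑ w' ∈ S, C (rowWeight t (z j) w w') * heckeT t i (A w') := by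
          rw [fillSum_succ, map_sum]
          refine Finset.sum_congr rfl fun w' _ => ?_
          rw [← smul_eq_C_mul, map_smul, smul_eq_C_mul]
      _ = ∑ w' ∈ S, C (rowWeight t (z j) w w' * diagCoeff t (pos w' a) (pos w' b)) * A w' +
          ∑ w' ∈ S, C (rowWeight t (z j) w w' * swapCoeff t (pos w' a) (pos w' b)) *
            A (relabel s w') := by
          rw [← Finset.sum_add_distrib]
          refine Finset.sum_congr rfl fun w' hw' => ?_
          rw [hT w' hw', C_mul, C_mul]
          ring
      _ = ∑ w' ∈ S, C (rowWeight t (z j) w w' * diagCoeff t (pos w' a) (pos w' b)) * A w' +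
          ∑ w' ∈ S, C (rowWeight t (z j) w (relabel s w') *
            swapCoeff t (pos w' b) (pos w' a)) * A w' := by
          congr 1
          refine Finset.sum_nbij' (relabel s) (relabel s) hsS hsS
            (fun w' _ => relabel_swap_swap a b w') (fun w' _ => relabel_swap_swap a b w') ?_
          intro w' hw'
          have hw'' := (Finset.mem_filter.1 hw').2
          rw [relabel_swap_swap, pos_swap_left hw'', pos_swap_right hw'']
      _ = ∑ w' ∈ S, C (t * rowWeight t (z j) (relabel s w) w') * A w' := by
          rw [← Finset.sum_add_distrib]
          refine Finset.sum_congr rfl fun w' hw' => ?_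
          have hw'' := (Finset.mem_filter.1 hw').2
          rw [← add_mul, ← C_add]
          congr 2
          rw [rowWeight_eq hab ht _ hw hw'', rowWeight_eq hab ht _ hw (hw''.relabel s),
            rowWeight_eq hab ht _ (hw.relabel s) hw'', stableWeight_swap_right hab,
            stableWeight_swap_left hab, pos_swap_left hw'', pos_swap_right hw'',
            pos_swap_left hw, pos_swap_right hw]
          linear_combination (stableWeight a b t (z j) w w') *
            localWeight_exchange ht (hz j) hgood fun c => pos_ne_pos hw'' hab'
      _ = C t * fillSum μ t z (k + 1) j (relabel s w) := by
          rw [fillSum_succ, Finset.mul_sum]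
          refine Finset.sum_congr rfl fun w' _ => ?_
          rw [C_mul, mul_assoc]

end FillSum

section Cyclic

variable {K : Type*} [Field K] {m : ℕ}

theorem finRotate_val (x : Fin (m + 1)) :
    (finRotate (m + 1) x : ℕ) = if (x : ℕ) = m then 0 else (x : ℕ) + 1 := by
  split_ifs with h
  · have : x = Fin.last m := Fin.ext h
    rw [this, finRotate_last]
    rfl
  · rw [coe_finRotate_of_ne_last fun e => h (by rw [e]; rfl)]

/-- The effect of the cyclic relabelling on comparisons. -/
theorem ind_map_finRotate_lt (x y : WithTop (Fin (m + 1))) :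
    ind (WithTop.map (finRotate (m + 1)) x < WithTop.map (finRotate (m + 1)) y) =
      ind (x < y) + ind (x = (Fin.last m : Fin (m + 1)) ∧ y ≠ (Fin.last m : Fin (m + 1)) ∧ y ≠ ⊤) -
        ind (y = (Fin.last m : Fin (m + 1)) ∧ x ≠ (Fin.last m : Fin (m + 1)) ∧ x ≠ ⊤) := by
  induction x with
  | top => simp [ind]
  | coe x =>
    induction y with
    | top => simp [ind]
    | coe y =>
      simp only [ind, WithTop.map_coe, WithTop.coe_lt_coe, WithTop.coe_inj, ne_eq,
        WithTop.coe_ne_top, not_false_eq_true, and_true, Fin.lt_def, finRotate_val, Fin.ext_iff,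
        Fin.val_last]
      have := x.isLt
      have := y.isLt
      split_ifs <;> omega

theorem rowNA_relabel {n : ℕ} (e : Equiv.Perm (Fin n)) (w w' : Word n) :
    RowNA (relabel e w) (relabel e w') ↔ RowNA w w' := by
  simp only [RowNA, Ne, relabel_apply_eq_iff, relabel_eq_top]

theorem relabel_symm_relabel {n : ℕ} (e : Equiv.Perm (Fin n)) (w : Word n) :
    relabel e.symm (relabel e w) = w := by
  funext c
  unfold relabel
  cases w c <;> simp

theorem sum_ite_eq_elim_pos {n : ℕ} {w : Word n} (hw : WordInj w) (u : Fin n) (g : Fin n → ℤ) :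
    (∑ c, ind (w c = u) * g c) = (pos w u).elim 0 g := by
  have h : ∀ c, w c = u ↔ pos w u = some c := fun c => (pos_eq_some hw).symm
  simp only [ind, h]
  rcases pos w u with _ | c
  · simp
  · simp

open Classical in
theorem prod_ite_eq_elim_pos {n : ℕ} {M : Type*} [CommMonoid M] {w : Word n} (hw : WordInj w)
    (u : Fin n) (g : Fin n → M) :
    (∏ c, if w c = u then g c else 1) = (pos w u).elim 1 g := by
  have h : ∀ c, w c = u ↔ pos w u = some c := fun c => (pos_eq_some hw).symm
  simp only [h]
  rcases pos w u with _ | c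
  · simp
  · simp

variable (μ : Fin (m + 1) → ℕ)

theorem mem_aliveWords {n : ℕ} {μ : Fin n → ℕ} {j : ℕ} {w : Word n} :
    w ∈ aliveWords μ j ↔ ∀ c, w c = ⊤ ↔ μ c < j := by
  simp [aliveWords]

variable {μ} in
theorem rowDelta_finRotate {j : ℕ} {w w' : Word (m + 1)} (hw : WordInj w)
    (hwj : w ∈ aliveWords μ j) (hwj' : w' ∈ aliveWords μ (j + 1)) (hna : RowNA w w') :
    rowDelta (relabel (finRotate (m + 1)) w) (relabel (finRotate (m + 1)) w') = rowDelta w w' +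
      (pos w' (Fin.last m)).elim 0 (fun r =>
        -(∑ d, ind (r < d ∧ μ d = j)) - ∑ c, ind (c < r ∧ j < μ c)) +
      (pos w (Fin.last m)).elim 0 fun p => ∑ c, ind (c < p ∧ j < μ c) := by
  have hw' := hna.wordInj
  rw [mem_aliveWords] at hwj hwj'
  rw [← sum_ite_eq_elim_pos hw', ← sum_ite_eq_elim_pos hw]
  have h1 : (∑ x, ind (w' x = (Fin.last m : Fin (m + 1))) *
      (-(∑ d, ind (x < d ∧ μ d = j)) - ∑ c, ind (c < x ∧ j < μ c))) =
      ∑ c, ∑ d, (-(ind (w' c = (Fin.last m : Fin (m + 1))) * ind (c < d ∧ μ d = j)) -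
        ind (w' d = (Fin.last m : Fin (m + 1))) * ind (c < d ∧ j < μ c)) := by
    simp only [Finset.sum_sub_distrib, mul_sub, Finset.mul_sum, Finset.sum_neg_distrib, mul_neg]
    congr 1
    exact Finset.sum_comm
  have h2 : (∑ x, ind (w x = (Fin.last m : Fin (m + 1))) * ∑ c, ind (c < x ∧ j < μ c)) =
      ∑ c, ∑ d, ind (w d = (Fin.last m : Fin (m + 1))) * ind (c < d ∧ j < μ c) := by
    simp only [Finset.mul_sum]
    exact Finset.sum_comm
  rw [h1, h2]
  simp only [rowDelta, ← Finset.sum_add_distrib]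
  refine Finset.sum_congr rfl fun c _ => Finset.sum_congr rfl fun d _ => ?_
  by_cases hcd : c < d
  swap
  · simp [hcd, ind]
  have hn := hna c d hcd
  have e1 := hwj d
  have e2 := hwj' c
  have e3 := hwj' d
  simp only [relabel, ind_map_finRotate_lt, hcd, if_true, true_and]
  have hl : ((Fin.last m : Fin (m + 1)) : WithTop (Fin (m + 1))) ≠ ⊤ := WithTop.coe_ne_top
  have f1 : j < μ c ↔ w' c ≠ ⊤ := by rw [Ne, e2]; omega
  have f2 : μ d = j ↔ w' d = ⊤ ∧ w d ≠ ⊤ := by rw [Ne, e1, e3]; omega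
  have f3 : w d = ⊤ → w' d = ⊤ := by rw [e1, e3]; omega
  rw [f1, f2]
  generalize ((Fin.last m : Fin (m + 1)) : WithTop (Fin (m + 1))) = l at *
  generalize w' c = x, w' d = y, w d = v at *
  have key : ind (x = l ∧ y ≠ l ∧ y ≠ ⊤) - ind (y = l ∧ x ≠ l ∧ x ≠ ⊤) -
      ind (x = l ∧ v ≠ l ∧ v ≠ ⊤) + ind (v = l ∧ x ≠ l ∧ x ≠ ⊤) =
      -(ind (x = l) * ind (y = ⊤ ∧ v ≠ ⊤)) - ind (y = l) * ind (x ≠ ⊤) +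
        ind (v = l) * ind (x ≠ ⊤) := by
    clear h1 h2 e1 e2 e3 f1 f2 hwj hwj' hna
    unfold ind
    by_cases hx : x = l
    · subst hx
      have hn := hn hl
      simp only [hn.1.symm, hn.2.symm, hl, ne_eq, not_false_eq_true, not_true_eq_false, true_and,
        and_true, and_false, if_true, if_false]
      by_cases hv : v = ⊤
      · simp [hv, f3 hv]
      · by_cases hy : y = ⊤ <;> simp [hy, hv]
    · by_cases hx' : x = ⊤
      · subst hx'
        simp [hl.symm]
      · by_cases hy : y = l <;> by_cases hv : v = l <;> simp [hx, hx', hy, hv]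
  linear_combination key

/-- The exponent of `t` in the effect of the cyclic generator on a bottom row in row `j` that has
its largest letter in column `p`. -/
def cyclicExp (j : ℕ) (p : Fin (m + 1)) : ℤ :=
  ∑ k, ind (p < k ∧ j ≤ μ k ∧ μ k < μ p) - ∑ k, ind (k < p ∧ μ p < μ k)

/-- The effect of the cyclic generator on a bottom row in row `j` that has its largest letter in
the given position. -/
def cyclicCoeff (q t : K) (j : ℕ) (r : Option (Fin (m + 1))) : K :=
  r.elim 1 fun p => q ^ (μ p - j) * t ^ cyclicExp μ j p

/-- The parameter `q^{l(s)+1} t^{a(s)+1}` of the square `s = (c, j + 1)`. -/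
def squareParam {n : ℕ} (μ : Fin n → ℕ) (q t : K) (j : ℕ) (c : Fin n) : K :=
  q ^ (μ c - j) * t ^ (alpha μ c j + 1)

theorem card_filter_eq_sum_ind {ι : Type*} [Fintype ι] (p : ι → Prop) [DecidablePred p] :
    ((Finset.univ.filter p).card : ℤ) = ∑ k, ind (p k) := by
  rw [Finset.card_filter, Nat.cast_sum]
  refine Finset.sum_congr rfl fun k _ => ?_
  unfold ind
  split_ifs <;> rfl

theorem alpha_sub_eq_cyclicExp {j : ℕ} {r : Fin (m + 1)} (hr : j < μ r) :
    (alpha μ r j : ℤ) + (-(∑ d, ind (r < d ∧ μ d = j)) - ∑ c, ind (c < r ∧ j < μ c)) =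
      cyclicExp μ (j + 1) r := by
  simp only [alpha, cyclicExp, Nat.cast_add, card_filter_eq_sum_ind, ← Finset.sum_add_distrib,
    ← Finset.sum_sub_distrib, ← Finset.sum_neg_distrib]
  refine Finset.sum_congr rfl fun k _ => ?_
  simp only [ind, Fin.lt_def, Ne, Fin.ext_iff]
  split_ifs <;> omega

theorem sum_sub_alpha_eq_cyclicExp {j : ℕ} {p : Fin (m + 1)} (hp : j < μ p) :
    (∑ c, ind (c < p ∧ j < μ c)) - (alpha μ p j : ℤ) = -cyclicExp μ j p := by
  simp only [alpha, cyclicExp, Nat.cast_add, card_filter_eq_sum_ind, ← Finset.sum_add_distrib,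
    ← Finset.sum_sub_distrib, ← Finset.sum_neg_distrib]
  refine Finset.sum_congr rfl fun k _ => ?_
  simp only [ind, Fin.lt_def, Ne, Fin.ext_iff]
  split_ifs <;> omega

theorem sum_eq_cyclicExp {j : ℕ} {p : Fin (m + 1)} (hp : μ p = j) :
    (∑ c, ind (c < p ∧ j < μ c)) = -cyclicExp μ j p := by
  simp only [cyclicExp, ← Finset.sum_sub_distrib, ← Finset.sum_neg_distrib]
  refine Finset.sum_congr rfl fun k _ => ?_
  simp only [ind, Fin.lt_def]
  split_ifs <;> omega

open Classical in
theorem colWeight_finRotate {t z : K} (hz : z / t ≠ 0) {x y : WithTop (Fin (m + 1))}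
    (hxy : y = ⊤ → x = ⊤) :
    colWeight t z (WithTop.map (finRotate (m + 1)) y) (WithTop.map (finRotate (m + 1)) x) =
      colWeight t z y x * ((if x = (Fin.last m : Fin (m + 1)) then z / t else 1) *
        (if y = (Fin.last m : Fin (m + 1)) then (if x = ⊤ then 1 else (z / t)⁻¹) else 1)) := by
  induction x with
  | top => simp [colWeight]
  | coe x =>
    induction y with
    | top => simp at hxy
    | coe y =>
      simp only [colWeight, WithTop.map_coe, WithTop.coe_lt_coe, WithTop.coe_inj,
        WithTop.coe_ne_top, Fin.lt_def, finRotate_val, Fin.ext_iff, Fin.val_last, if_false]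
      have := x.isLt
      have := y.isLt
      by_cases hx : (x : ℕ) = m <;> by_cases hy : (y : ℕ) = m
      · have h0 := mul_inv_cancel₀ hz
        rw [inv_div] at h0
        simp [hx, hy, h0]
      · have h1 : (y : ℕ) < m := by omega
        simp [hx, hy, h1, mul_comm]
      · have h1 : (x : ℕ) < m := by omega
        simp only [hx, hy, h1, h1.not_gt, if_true, if_false, Nat.zero_lt_succ, one_mul]
        rw [mul_comm (z / t), mul_assoc, mul_inv_cancel₀ hz, mul_one]
      · simp [hx, hy]

theorem rowWeight_finRotate {q t : K} (hq : q ≠ 0) (ht : t ≠ 0) {j : ℕ} {w w' : Word (m + 1)}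
    (hw : WordInj w) (hwj : w ∈ aliveWords μ j) (hwj' : w' ∈ aliveWords μ (j + 1)) :
    cyclicCoeff μ q t j (pos w (Fin.last m)) *
        rowWeight t (squareParam μ q t j) (relabel (finRotate (m + 1)) w)
          (relabel (finRotate (m + 1)) w') =
      rowWeight t (squareParam μ q t j) w w' *
        ((pos w' (Fin.last m)).elim 1 (fun _ => q) *
          cyclicCoeff μ q t (j + 1) (pos w' (Fin.last m))) := by
  classical
  unfold rowWeight
  rw [if_congr (rowNA_relabel _ w w') rfl rfl]
  split_ifs with hna
  swap
  · simp
  have hw' := hna.wordInj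
  rw [rowDelta_finRotate hw hwj hwj' hna]
  rw [mem_aliveWords] at hwj hwj'
  have hz : ∀ c, squareParam μ q t j c / t = q ^ (μ c - j) * t ^ (alpha μ c j : ℤ) := by
    intro c
    rw [squareParam, pow_succ, zpow_natCast]
    field_simp
  have hz0 : ∀ c, squareParam μ q t j c / t ≠ 0 := fun c => by
    rw [hz]; exact mul_ne_zero (pow_ne_zero _ hq) (zpow_ne_zero _ ht)
  have htop : ∀ c, w c = ⊤ → w' c = ⊤ := fun c => by rw [hwj, hwj']; omega
  have hprod : (∏ c, colWeight t (squareParam μ q t j c) (relabel (finRotate (m + 1)) w c)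
      (relabel (finRotate (m + 1)) w' c)) =
      (∏ c, colWeight t (squareParam μ q t j c) (w c) (w' c)) *
        ((pos w' (Fin.last m)).elim 1 (fun c => squareParam μ q t j c / t) *
          (pos w (Fin.last m)).elim 1
            (fun c => if w' c = ⊤ then 1 else (squareParam μ q t j c / t)⁻¹)) := by
    rw [← prod_ite_eq_elim_pos hw', ← prod_ite_eq_elim_pos hw, ← Finset.prod_mul_distrib,
      ← Finset.prod_mul_distrib]
    exact Finset.prod_congr rfl fun c _ => colWeight_finRotate (hz0 c) (htop c)
  rw [hprod, zpow_add₀ ht, zpow_add₀ ht]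
  have hup : (pos w' (Fin.last m)).elim 1 (fun c => squareParam μ q t j c / t) *
      t ^ ((pos w' (Fin.last m)).elim 0 (fun r =>
        -(∑ d, ind (r < d ∧ μ d = j)) - ∑ c, ind (c < r ∧ j < μ c))) =
      (pos w' (Fin.last m)).elim 1 (fun _ => q) *
          cyclicCoeff μ q t (j + 1) (pos w' (Fin.last m)) := by
    rcases hr : pos w' (Fin.last m) with _ | r
    · simp [cyclicCoeff]
    · have hjr : j < μ r := by
        have h1 := (pos_eq_some hw').1 hr
        have h2 := (hwj' r).not.1 (by rw [h1]; exact WithTop.coe_ne_top)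
        omega
      simp only [Option.elim, cyclicCoeff]
      rw [hz, mul_assoc, ← zpow_add₀ ht, alpha_sub_eq_cyclicExp μ hjr, ← mul_assoc, ← pow_succ']
      congr 3
      omega
  have hdown : cyclicCoeff μ q t j (pos w (Fin.last m)) *
      ((pos w (Fin.last m)).elim 1
        (fun c => if w' c = ⊤ then 1 else (squareParam μ q t j c / t)⁻¹) *
      t ^ ((pos w (Fin.last m)).elim 0 fun p => ∑ c, ind (c < p ∧ j < μ c))) = 1 := by
    rcases hp : pos w (Fin.last m) with _ | p
    · simp [cyclicCoeff]
    · have hjp : j ≤ μ p := by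
        have h1 := (pos_eq_some hw).1 hp
        have h2 := (hwj p).not.1 (by rw [h1]; exact WithTop.coe_ne_top)
        omega
      simp only [Option.elim, cyclicCoeff]
      rcases hjp.eq_or_lt with h | h
      · rw [if_pos ((hwj' p).2 (by omega)), sum_eq_cyclicExp μ h.symm, one_mul, mul_assoc,
          ← zpow_add₀ ht, h, Nat.sub_self]
        simp
      · rw [if_neg fun h' => by have := (hwj' p).1 h'; omega, hz, mul_inv, ← zpow_neg,
          mul_assoc (q ^ (μ p - j))⁻¹, ← zpow_add₀ ht, neg_add_eq_sub,
          sum_sub_alpha_eq_cyclicExp μ h, zpow_neg, ← mul_inv]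
        exact mul_inv_cancel₀ (mul_ne_zero (pow_ne_zero _ hq) (zpow_ne_zero _ ht))
  linear_combination ((∏ c, colWeight t (squareParam μ q t j c) (w c) (w' c)) *
    t ^ rowDelta w w') * (hup + ((pos w' (Fin.last m)).elim 1
      (fun c => squareParam μ q t j c / t) *
      t ^ ((pos w' (Fin.last m)).elim 0 (fun r =>
        -(∑ d, ind (r < d ∧ μ d = j)) - ∑ c, ind (c < r ∧ j < μ c)))) * hdown)

theorem omega_mul {n : ℕ} (q : K) (f g : MvPolynomial (Fin n) K) :
    omega q (f * g) = omega q f * omega q g := by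
  simp [omega]

theorem omega_C {n : ℕ} (q : K) (c : K) : omega q (C c : MvPolynomial (Fin n) K) = C c := by
  simp only [omega, AlgHom.toLinearMap_apply, algHom_C, algebraMap_eq]

theorem omega_X (q : K) (x : Fin (m + 1)) :
    omega q (X x : MvPolynomial (Fin (m + 1)) K) =
      X (finRotate (m + 1) x) * if x = Fin.last m then C q else 1 := by
  simp only [omega, AlgHom.toLinearMap_apply, aeval_X]
  split_ifs with h1 h2 h2
  · rw [h2] at h1; simp at h1
  · rw [mul_one]
    congr 1
    ext
    rw [finRotate_val, if_neg (by omega)]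
  · rw [h2, finRotate_last, mul_comm]
    rfl
  · exact (h2 (Fin.ext (by have := x.isLt; simp; omega))).elim

open Classical in
theorem omega_wordMonomial (q : K) {w : Word (m + 1)} (hw : WordInj w) :
    omega q (wordMonomial K w) = C ((pos w (Fin.last m)).elim 1 (fun _ => q)) *
      wordMonomial K (relabel (finRotate (m + 1)) w) := by
  have h : ∀ s : Finset (Fin (m + 1)), omega q (∏ c ∈ s, letterVar K (w c)) =
      ∏ c ∈ s, omega q (letterVar K (w c)) := by
    intro s
    simp only [omega, AlgHom.toLinearMap_apply, map_prod]
  have h1 : omega q (1 : MvPolynomial (Fin (m + 1)) K) = 1 := by rw [← C_1, omega_C]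
  rw [← prod_ite_eq_elim_pos hw, map_prod, wordMonomial, h, wordMonomial,
    ← Finset.prod_mul_distrib]
  refine Finset.prod_congr rfl fun c _ => ?_
  unfold relabel
  cases hx : w c with
  | top => simp [letterVar, h1]
  | coe x =>
    simp only [letterVar, WithTop.map_coe, WithTop.recTopCoe_coe, omega_X, WithTop.coe_inj]
    split_ifs <;> simp [mul_comm]

/-- The cyclic generator relabels the bottom row cyclically. -/
theorem omega_fillSum {q t : K} (hq : q ≠ 0) (ht : t ≠ 0) (k : ℕ) :
    ∀ (j : ℕ) (w : Word (m + 1)), (∀ c, μ c ≤ j + k) → WordInj w → w ∈ aliveWords μ j →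
      omega q (fillSum μ t (squareParam μ q t) k j w) =
        C (cyclicCoeff μ q t j (pos w (Fin.last m))) *
          fillSum μ t (squareParam μ q t) k j (relabel (finRotate (m + 1)) w) := by
  classical
  induction k with
  | zero =>
    intro j w hμ hw hwj
    have hc : cyclicCoeff μ q t j (pos w (Fin.last m)) = 1 := by
      rcases hp : pos w (Fin.last m) with _ | p
      · rfl
      · have h1 := (pos_eq_some hw).1 hp
        have h2 := (mem_aliveWords.1 hwj p).not.1 (by rw [h1]; exact WithTop.coe_ne_top)
        have h3 : μ p = j := le_antisymm (hμ p) (by omega)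
        have h4 : cyclicExp μ j p = 0 := by
          rw [← neg_eq_zero, ← sum_eq_cyclicExp μ h3]
          refine Finset.sum_eq_zero fun c _ => ?_
          rw [ind, if_neg]
          have := hμ c
          omega
        simp [cyclicCoeff, h4, h3]
    rw [hc, C_1, one_mul, fillSum, fillSum, ← C_1, omega_C]
  | succ k ih =>
    intro j w hμ hw hwj
    rw [fillSum_succ, fillSum_succ, map_sum, Finset.mul_sum]
    refine Finset.sum_nbij' (relabel (finRotate (m + 1))) (relabel (finRotate (m + 1)).symm)
      ?_ ?_ ?_ ?_ ?_
    · intro w' hw'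
      rw [Finset.mem_filter] at hw' ⊢
      exact ⟨(relabel_mem_aliveWords _).2 hw'.1, hw'.2.relabel _⟩
    · intro w' hw'
      rw [Finset.mem_filter] at hw' ⊢
      exact ⟨(relabel_mem_aliveWords _).2 hw'.1, hw'.2.relabel _⟩
    · exact fun w' _ => relabel_symm_relabel _ w'
    · exact fun w' _ => relabel_symm_relabel (finRotate (m + 1)).symm w'
    · intro w' hw'
      rw [Finset.mem_filter] at hw'
      rw [omega_mul, omega_mul, omega_C, omega_wordMonomial q hw'.2,
        ih (j + 1) w' (fun c => by have := hμ c; omega) hw'.2 hw'.1]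
      have h := congrArg (C (σ := Fin (m + 1))) (rowWeight_finRotate μ hq ht hw hwj hw'.1)
      simp only [C_mul] at h
      linear_combination (-(wordMonomial K (relabel (finRotate (m + 1)) w') *
        fillSum μ t (squareParam μ q t) k (j + 1) (relabel (finRotate (m + 1)) w'))) * h

end Cyclic

section Eigen

variable {K : Type*} [Field K] {m : ℕ}

/-- The word with the given letters, without empty squares. -/
def wordOf {n : ℕ} (f : Fin n → Fin n) : Word n := fun c => f c

theorem wordInj_wordOf {n : ℕ} {f : Fin n → Fin n} (hf : Function.Injective f) :
    WordInj (wordOf f) := fun _ _ h _ => hf (WithTop.coe_inj.1 h)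

theorem pos_wordOf {n : ℕ} {f : Fin n → Fin n} (hf : Function.Injective f) {c u : Fin n}
    (h : f c = u) : pos (wordOf f) u = some c :=
  (pos_eq_some (wordInj_wordOf hf)).2 (WithTop.coe_inj.2 h)

theorem wordOf_mem_aliveWords {n : ℕ} (f : Fin n → Fin n) (μ : Fin n → ℕ) :
    wordOf f ∈ aliveWords μ 0 := by
  simp [mem_aliveWords, wordOf]

theorem relabel_wordOf {n : ℕ} (e : Equiv.Perm (Fin n)) (f : Fin n → Fin n) :
    relabel e (wordOf f) = wordOf (e ∘ f) := rfl

theorem squareParam_ne_one {n : ℕ} {q t : K} (hqt : ∀ a b : ℤ, q ^ a * t ^ b = 1 → a = 0 ∧ b = 0)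
    (μ : Fin n → ℕ) (j : ℕ) (c : Fin n) : squareParam μ q t j c ≠ 1 := by
  intro h
  have := (hqt ((μ c - j : ℕ) : ℤ) ((alpha μ c j + 1 : ℕ) : ℤ)
    (by rw [zpow_natCast, zpow_natCast]; exact h)).2
  omega

/-- The generating function of the fillings with bottom row `f`. -/
def basementSum {n : ℕ} (q t : K) (μ : Fin n → ℕ) (N : ℕ) (f : Fin n → Fin n) :
    MvPolynomial (Fin n) K := fillSum μ t (squareParam μ q t) N 0 (wordOf f)

theorem heckeT_basementSum {n : ℕ} {q t : K} (ht : t ≠ 0)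
    (hqt : ∀ a b : ℤ, q ^ a * t ^ b = 1 → a = 0 ∧ b = 0) (μ : Fin n → ℕ) (N : ℕ)
    {f g : Fin n → Fin n} (hf : Function.Injective f) {k : ℕ} (hk : k + 1 < n) {c d : Fin n}
    (hcd : d < c) (hc : f c = ⟨k, by omega⟩) (hd : f d = ⟨k + 1, hk⟩)
    (hg : ∀ c, g c = Equiv.swap (⟨k, by omega⟩ : Fin n) ⟨k + 1, hk⟩ (f c)) :
    heckeT t k (basementSum q t μ N f) = t • basementSum q t μ N g := by
  have hg' : relabel (Equiv.swap ⟨k, by omega⟩ ⟨k + 1, hk⟩) (wordOf f) = wordOf g := by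
    rw [relabel_wordOf]
    congr 1
    funext c
    exact (hg c).symm
  rw [basementSum, basementSum, heckeT_fillSum μ ht (squareParam_ne_one hqt μ) hk rfl rfl N 0 _
    (wordInj_wordOf hf), hg', smul_eq_C_mul]
  rw [pos_wordOf hf hc, pos_wordOf hf hd]
  exact hcd

/-- The rotation of the letters `i, …, k` that sends column `i` to `k`. -/
def rotUp (i k : ℕ) (c : Fin (m + 1)) : Fin (m + 1) :=
  if h : (c : ℕ) = i ∧ k ≤ m then ⟨k, by omega⟩
  else if i < c ∧ (c : ℕ) ≤ k then ⟨c - 1, by omega⟩ else c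

theorem rotUp_val {i k : ℕ} (hk : k ≤ m) (c : Fin (m + 1)) : (rotUp i k c : ℕ) =
    if (c : ℕ) = i then k else if i < c ∧ (c : ℕ) ≤ k then (c : ℕ) - 1 else c := by
  unfold rotUp
  split_ifs <;> first | rfl | omega

theorem rotUp_injective {i k : ℕ} (hi : i ≤ k) (hk : k ≤ m) :
    Function.Injective (rotUp (m := m) i k) := by
  intro c d h
  rw [Fin.ext_iff, rotUp_val hk, rotUp_val hk] at h
  rw [Fin.ext_iff]
  split_ifs at h <;> omega

theorem heckeTInv_prod_basementSum {q t : K} (ht : t ≠ 0)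
    (hqt : ∀ a b : ℤ, q ^ a * t ^ b = 1 → a = 0 ∧ b = 0) (μ : Fin (m + 1) → ℕ) (N : ℕ)
    (i : ℕ) (l : ℕ) (hl : i + l ≤ m) :
    ((List.range' i l).reverse.map (heckeTInv t)).prod (basementSum q t μ N id) =
      (t⁻¹) ^ l • basementSum q t μ N (rotUp i (i + l)) := by
  induction l with
  | zero =>
    have : rotUp (m := m) i (i + 0) = id := by
      funext c
      rw [Fin.ext_iff, rotUp_val hl]
      simp only [id]
      split_ifs <;> omega
    rw [this]
    simp
  | succ l ih =>
    have h1 : heckeT t (i + l) (basementSum q t μ N (rotUp i (i + l + 1))) =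
        t • basementSum q t μ N (rotUp i (i + l)) := by
      refine heckeT_basementSum ht hqt μ N (rotUp_injective (by omega) (by omega))
        (by omega : i + l + 1 < m + 1) (c := ⟨i + l + 1, by omega⟩) (d := ⟨i, by omega⟩) ?_ ?_ ?_ ?_
      · rw [Fin.lt_def]; simp only; omega
      · rw [Fin.ext_iff, rotUp_val (by omega)]
        simp only
        split_ifs <;> omega
      · rw [Fin.ext_iff, rotUp_val (by omega)]
        simp
      · intro c
        rw [Equiv.swap_apply_def]
        have h2 := rotUp_val (i := i) (k := i + l) (by omega) c
        have h3 := rotUp_val (i := i) (k := i + l + 1) (by omega) c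
        simp only [Fin.ext_iff, apply_ite Fin.val, h2, h3]
        split_ifs <;> omega
    have h4 := congrArg (heckeTInv t (i + l)) h1
    rw [heckeTInv_heckeT ht (by omega), map_smul] at h4
    rw [List.range'_1_concat, List.reverse_append, List.map_append, List.prod_append]
    simp only [List.reverse_singleton, List.map_singleton, List.prod_singleton,
      Module.End.mul_apply]
    rw [ih (by omega), map_smul, ← add_assoc, h4, smul_smul, pow_succ, mul_assoc,
      inv_mul_cancel₀ ht, mul_one]

/-- The rotation of the letters `k, …, i` that sends column `i` to `k`. -/
def rotDown (i k : ℕ) (c : Fin (m + 1)) : Fin (m + 1) :=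
  if h : (c : ℕ) = i ∧ k ≤ m then ⟨k, by omega⟩
  else if h : k ≤ c ∧ (c : ℕ) < i ∧ i ≤ m then ⟨c + 1, by omega⟩ else c

theorem rotDown_val {i k : ℕ} (hk : k ≤ m) (hi : i ≤ m) (c : Fin (m + 1)) :
    (rotDown i k c : ℕ) =
      if (c : ℕ) = i then k else if k ≤ c ∧ (c : ℕ) < i then (c : ℕ) + 1 else c := by
  unfold rotDown
  split_ifs <;> first | rfl | omega

theorem rotDown_injective {i k : ℕ} (hi : i ≤ m) (hk : k ≤ i) :
    Function.Injective (rotDown (m := m) i k) := by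
  intro c d h
  rw [Fin.ext_iff, rotDown_val (by omega) hi, rotDown_val (by omega) hi] at h
  rw [Fin.ext_iff]
  split_ifs at h <;> omega

theorem heckeT_prod_basementSum {q t : K} (ht : t ≠ 0)
    (hqt : ∀ a b : ℤ, q ^ a * t ^ b = 1 → a = 0 ∧ b = 0) (μ : Fin (m + 1) → ℕ) (N : ℕ)
    {i : ℕ} (hi : i ≤ m) (k : ℕ) (hk : k ≤ i) :
    ((List.range k).reverse.map (heckeT t)).prod (basementSum q t μ N (rotDown i 0)) =
      t ^ k • basementSum q t μ N (rotDown i k) := by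
  induction k with
  | zero => simp
  | succ k ih =>
    have h1 : heckeT t k (basementSum q t μ N (rotDown i k)) =
        t • basementSum q t μ N (rotDown i (k + 1)) := by
      refine heckeT_basementSum ht hqt μ N (rotDown_injective hi (by omega))
        (by omega : k + 1 < m + 1) (c := ⟨i, by omega⟩) (d := ⟨k, by omega⟩) ?_ ?_ ?_ ?_
      · rw [Fin.lt_def]; simp only; omega
      · rw [Fin.ext_iff, rotDown_val (by omega) hi]
        simp
      · rw [Fin.ext_iff, rotDown_val (by omega) hi]
        simp only
        split_ifs <;> omega
      · intro c
        rw [Equiv.swap_apply_def]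
        have h2 := rotDown_val (i := i) (k := k) (by omega) hi c
        have h3 := rotDown_val (i := i) (k := k + 1) (by omega) hi c
        simp only [Fin.ext_iff, apply_ite Fin.val, h2, h3]
        split_ifs <;> omega
    rw [List.range_succ, List.reverse_append, List.map_append, List.prod_append]
    simp only [List.reverse_singleton, List.map_singleton, List.prod_singleton,
      Module.End.mul_apply]
    rw [ih (by omega), map_smul, h1, smul_smul, pow_succ]

theorem cyclicExp_zero (μ : Fin (m + 1) → ℕ) (i : Fin (m + 1)) :
    cyclicExp μ 0 i = eta μ i + (m - i : ℕ) := by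
  have h : ((m - i : ℕ) : ℤ) = ∑ k, ind (i < k) := by
    rw [← card_filter_eq_sum_ind, Finset.filter_lt_eq_Ioi, Fin.card_Ioi]
    simp
  rw [h]
  simp only [eta, cyclicExp, card_filter_eq_sum_ind, ← Finset.sum_add_distrib,
    ← Finset.sum_sub_distrib, ← Finset.sum_neg_distrib]
  refine Finset.sum_congr rfl fun k _ => ?_
  simp only [ind, Fin.lt_def]
  split_ifs <;> omega

theorem cherednikY_basementSum {n : ℕ} {q t : K} (hq : q ≠ 0) (ht : t ≠ 0)
    (hqt : ∀ a b : ℤ, q ^ a * t ^ b = 1 → a = 0 ∧ b = 0) (μ : Fin n → ℕ) {N : ℕ}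
    (hN : ∀ c, μ c ≤ N) (i : Fin n) :
    cherednikY q t i (basementSum q t μ N id) =
      eigenvalueY q t μ i • basementSum q t μ N id := by
  obtain ⟨m, rfl⟩ : ∃ m, n = m + 1 := ⟨n - 1, by have := i.isLt; omega⟩
  have him : (i : ℕ) ≤ m := by omega
  have hrot := rotUp_injective (m := m) (i := i) (k := i + (m + 1 - 1 - i)) (by omega) (by omega)
  have hpos : pos (wordOf (rotUp (m := m) i (i + (m + 1 - 1 - i)))) (Fin.last m) = some i := by
    refine pos_wordOf hrot ?_
    rw [Fin.ext_iff, rotUp_val (by omega)]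
    simp
    omega
  have hω : omega q (basementSum q t μ N (rotUp i (i + (m + 1 - 1 - i)))) =
      (q ^ μ i * t ^ cyclicExp μ 0 i) • basementSum q t μ N (rotDown i 0) := by
    have hrel : relabel (finRotate (m + 1)) (wordOf (rotUp (m := m) i (i + (m + 1 - 1 - i)))) =
        wordOf (rotDown i 0) := by
      rw [relabel_wordOf]
      congr 1
      funext c
      rw [Fin.ext_iff, rotDown_val (by omega) him, Function.comp, finRotate_val,
        rotUp_val (by omega)]
      split_ifs <;> omega
    rw [basementSum, omega_fillSum μ hq ht N 0 _ (by simpa using hN) (wordInj_wordOf hrot)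
      (wordOf_mem_aliveWords _ μ), hrel, hpos, smul_eq_C_mul]
    rfl
  have hid : rotDown (m := m) i i = id := by
    funext c
    rw [Fin.ext_iff, rotDown_val him him]
    simp only [id]
    split_ifs <;> omega
  rw [cherednikY, Module.End.mul_apply, Module.End.mul_apply,
    heckeTInv_prod_basementSum ht hqt μ N i _ (by omega), map_smul, hω, map_smul, map_smul,
    heckeT_prod_basementSum ht hqt μ N him i le_rfl, hid, smul_smul, smul_smul]
  congr 1
  rw [eigenvalueY, cyclicExp_zero, ← zpow_natCast t (i : ℕ), zpow_add₀ ht, zpow_add₀ ht,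
    zpow_natCast t (m - i), inv_pow]
  have : (t ^ (m - (i : ℕ))) ≠ 0 := pow_ne_zero _ ht
  rw [show m + 1 - 1 - (i : ℕ) = m - i by omega]
  field_simp

end Eigen

section Fillings

variable {K : Type*} [Field K] {n : ℕ}

theorem fillSum_eq_sum (μ : Fin n → ℕ) (t : K) (z : ℕ → Fin n → K) (k : ℕ) :
    ∀ (j : ℕ) (w : Word n), fillSum μ t z k j w =
      ∑ ρ ∈ Fintype.piFinset (fun i : Fin k => aliveWords μ (j + 1 + i)),
        ∏ i : Fin k, (C (rowWeight t (z (j + i))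
          (Fin.cons (α := fun _ => Word n) w ρ i.castSucc) (ρ i)) * wordMonomial K (ρ i)) := by
  induction k with
  | zero => intro j w; simp [fillSum]
  | succ k ih =>
    intro j w
    simp only [fillSum, ih, Finset.mul_sum]
    rw [← Finset.sum_product']
    refine Finset.sum_nbij' (fun x => Fin.cons x.1 x.2) (fun ρ => (ρ 0, Fin.tail ρ))
      ?_ ?_ ?_ ?_ ?_
    · rintro ⟨w', ρ⟩ h
      rw [Finset.mem_product, Fintype.mem_piFinset] at h
      rw [Fintype.mem_piFinset]
      intro i
      refine Fin.cases ?_ (fun i => ?_) i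
      · simpa using h.1
      · have := h.2 i
        simp only [Fin.cons_succ, Fin.val_succ]
        convert this using 2
        ring
    · intro ρ h
      rw [Fintype.mem_piFinset] at h
      rw [Finset.mem_product, Fintype.mem_piFinset]
      refine ⟨by simpa using h 0, fun i => ?_⟩
      have := h i.succ
      simp only [Fin.val_succ] at this
      simp only [Fin.tail]
      convert this using 2
      ring
    · rintro ⟨w', ρ⟩ _
      simp
    · intro ρ _
      exact Fin.cons_self_tail ρ
    · rintro ⟨w', ρ⟩ _
      rw [Fin.prod_univ_succ]
      simp only [Fin.cons_zero, Fin.castSucc_zero, Fin.cons_succ, Fin.val_zero, add_zero,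
        ← Fin.succ_castSucc, Fin.val_succ]
      rw [mul_assoc]
      congr 2
      refine Finset.prod_congr rfl fun i _ => ?_
      rw [show j + 1 + (i : ℕ) = j + (i + 1) by ring]

variable {μ : Fin n → ℕ}

/-- A row of a filling. -/
def Filling.row (σ : Filling μ) (j : ℕ) : Word n := fun c => σ.entry ⟨c, j⟩

theorem Filling.row_of_le (σ : Filling μ) {j : ℕ} {c : Fin n} (h : j ≤ μ c) :
    σ.row j c = (σ.1 c ⟨j, by omega⟩ : Fin n) := by
  simp only [row, entry]
  rw [dif_pos (by omega)]

theorem Filling.row_eq_top (σ : Filling μ) {j : ℕ} {c : Fin n} : σ.row j c = ⊤ ↔ μ c < j := by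
  simp only [row, entry]
  split_ifs with h
  · simp only [WithTop.coe_ne_top, false_iff]
    omega
  · simp only [true_iff]
    omega

theorem Filling.row_zero (σ : Filling μ) : σ.row 0 = wordOf id := by
  funext c
  rw [σ.row_of_le (Nat.zero_le _)]
  exact congrArg _ (σ.2 c)

theorem Filling.nonAttacking_iff (σ : Filling μ) {N : ℕ} (hN : ∀ c, μ c ≤ N) :
    σ.NonAttacking ↔ ∀ j < N, RowNA (σ.row j) (σ.row (j + 1)) := by
  have hext : ∀ c j, (⟨c, j⟩ : Σ _ : Fin n, ℕ) ∈ extDg μ ↔ σ.row j c ≠ ⊤ := by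
    intro c j
    rw [Ne, σ.row_eq_top]
    simp [extDg]
  constructor
  · intro h j _ c d hcd hc
    refine ⟨fun h1 => ?_, fun h1 => ?_⟩
    · exact h ⟨c, j + 1⟩ ((hext _ _).2 hc) ⟨d, j + 1⟩ ((hext _ _).2 (h1 ▸ hc)) ⟨hcd, .inl rfl⟩ h1
    · exact h ⟨c, j + 1⟩ ((hext _ _).2 hc) ⟨d, j⟩ ((hext _ _).2 (h1 ▸ hc)) ⟨hcd, .inr rfl⟩ h1
  · rintro h ⟨c, j⟩ hs ⟨d, j'⟩ hs' ⟨hcd, hj⟩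
    simp only at hcd hj
    rw [hext] at hs
    rcases j with _ | j
    · obtain rfl : j' = 0 := by omega
      change σ.row 0 c ≠ σ.row 0 d
      rw [σ.row_zero]
      exact fun h => hcd.ne (WithTop.coe_inj.1 h)
    · have hjN : j < N := by
        rw [Ne, σ.row_eq_top] at hs
        have := hN c
        omega
      rcases hj with rfl | hj
      · exact (h j hjN c d hcd hs).1
      · obtain rfl : j = j' := by omega
        exact (h j hjN c d hcd hs).2

@[to_additive]
theorem prod_dg_eq {M : Type*} [CommMonoid M] {N : ℕ} (hN : ∀ c, μ c ≤ N)
    (g : (Σ _ : Fin n, ℕ) → M) :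
    ∏ s ∈ dg μ, g s = ∏ j ∈ Finset.range N, ∏ c, if j < μ c then g ⟨c, j + 1⟩ else 1 := by
  rw [dg, Finset.prod_sigma, Finset.prod_comm]
  refine Finset.prod_congr rfl fun c _ => ?_
  rw [← Finset.prod_filter]
  refine Finset.prod_nbij' (fun j => j - 1) (fun j => j + 1) ?_ ?_ ?_ ?_ ?_
  · intro j hj
    rw [Finset.mem_Icc] at hj
    rw [Finset.mem_filter, Finset.mem_range]
    have := hN c
    omega
  · intro j hj
    rw [Finset.mem_filter, Finset.mem_range] at hj
    rw [Finset.mem_Icc]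
    omega
  · intro j hj
    rw [Finset.mem_Icc] at hj
    omega
  · intro j _
    simp
  · intro j hj
    rw [Finset.mem_Icc] at hj
    rw [Nat.sub_add_cancel hj.1]

theorem Filling.delta_eq (σ : Filling μ) {N : ℕ} (hN : ∀ c, μ c ≤ N)
    (hσ : ∀ j < N, RowNA (σ.row j) (σ.row (j + 1))) :
    σ.delta = ∑ j ∈ Finset.range N, rowDelta (σ.row j) (σ.row (j + 1)) := by
  have hsum : ∀ (p : (Σ _ : Fin n, ℕ) × Fin n → Prop) [DecidablePred p],
      (((triples μ).filter p).card : ℤ) = ∑ s ∈ dg μ, ∑ d,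
        if s.1 < d ∧ ⟨d, s.2 - 1⟩ ∈ extDg μ then ind (p (s, d)) else 0 := by
    intro p _
    rw [Finset.card_filter, triples, Finset.sum_filter, Finset.sum_product, Nat.cast_sum]
    refine Finset.sum_congr rfl fun s _ => ?_
    rw [Nat.cast_sum]
    refine Finset.sum_congr rfl fun d _ => ?_
    simp only [ind]
    split_ifs <;> rfl
  rw [delta, ordPos, ordNeg, hsum, hsum, ← Finset.sum_sub_distrib, sum_dg_eq hN]
  refine Finset.sum_congr rfl fun j hj => Finset.sum_congr rfl fun c _ => ?_
  rw [Finset.mem_range] at hj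
  simp only [Nat.add_sub_cancel]
  split_ifs with hjc
  · rw [← Finset.sum_sub_distrib]
    refine Finset.sum_congr rfl fun d _ => ?_
    by_cases hcd : c < d
    swap
    · simp [hcd]
    have hx : σ.row (j + 1) c ≠ ⊤ := by
      rw [Ne, σ.row_eq_top]
      omega
    have h1 := hσ j hj c d hcd hx
    change (if c < d ∧ ⟨d, j⟩ ∈ extDg μ then
        ind (σ.row (j + 1) c < σ.row (j + 1) d ∧ σ.row j d < σ.row (j + 1) c) else 0) -
      (if c < d ∧ ⟨d, j⟩ ∈ extDg μ then
        ind (σ.row (j + 1) d < σ.row (j + 1) c ∧ σ.row (j + 1) c < σ.row j d) else 0) = _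
    have hd : ⟨d, j⟩ ∈ extDg μ ↔ σ.row j d ≠ ⊤ := by
      rw [Ne, σ.row_eq_top]
      simp [extDg]
    have hd' : σ.row j d = ⊤ → σ.row (j + 1) d = ⊤ := by
      rw [σ.row_eq_top, σ.row_eq_top]
      omega
    simp only [hd]
    generalize σ.row (j + 1) c = x, σ.row (j + 1) d = y, σ.row j d = v at *
    by_cases hv : v = ⊤
    · simp [hv, hd' hv]
    · simp only [hcd, hv, ne_eq, not_false_eq_true, and_self, if_true]
      rcases lt_or_gt_of_ne h1.1 with h2 | h2 <;> rcases lt_or_gt_of_ne h1.2 with h3 | h3 <;>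
        simp [ind, h2, h3, h2.not_gt, h3.not_gt]
  · refine (Finset.sum_eq_zero fun d _ => ?_).symm
    have hx : σ.row (j + 1) c = ⊤ := by
      rw [σ.row_eq_top]
      omega
    simp [hx, ind]

theorem Filling.xpow_eq (σ : Filling μ) {N : ℕ} (hN : ∀ c, μ c ≤ N) :
    σ.xpow K = ∏ j ∈ Finset.range N, wordMonomial K (σ.row (j + 1)) := by
  simp only [xpow, wordMonomial]
  rw [Finset.prod_comm]
  refine Finset.prod_congr rfl fun c _ => ?_
  rw [← Finset.prod_subset (Finset.range_subset_range.2 (hN c)), Finset.prod_range]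
  · refine Finset.prod_congr rfl fun j _ => ?_
    rw [σ.row_of_le (by omega)]
    rfl
  · intro j _ hj
    rw [σ.row_eq_top.2 (by rw [Finset.mem_range] at hj; omega)]
    rfl

theorem Filling.prod_colWeight_eq (σ : Filling μ) {q t : K} (ht : t ≠ 0) {N : ℕ}
    (hN : ∀ c, μ c ≤ N) :
    (∏ s ∈ σ.descents, (1 - t) / (1 - q ^ (leg μ s + 1) * t ^ (arm μ s + 1))) *
      (∏ s ∈ σ.ascents, (q ^ (leg μ s + 1) * t ^ arm μ s * (1 - t)) /
        (1 - q ^ (leg μ s + 1) * t ^ (arm μ s + 1))) =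
    ∏ j ∈ Finset.range N, ∏ c,
      colWeight t (squareParam μ q t j c) (σ.row j c) (σ.row (j + 1) c) := by
  rw [descents, ascents, Finset.prod_filter, Finset.prod_filter, ← Finset.prod_mul_distrib,
    prod_dg_eq hN]
  refine Finset.prod_congr rfl fun j _ => Finset.prod_congr rfl fun c _ => ?_
  by_cases hjc : j < μ c
  · rw [if_pos hjc]
    have hx : σ.row (j + 1) c ≠ ⊤ := by
      rw [Ne, σ.row_eq_top]
      omega
    have hp : q ^ (leg μ ⟨c, j + 1⟩ + 1) * t ^ (arm μ ⟨c, j + 1⟩ + 1) = squareParam μ q t j c := by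
      simp only [squareParam, leg, arm, Nat.add_sub_cancel]
      congr 2
      omega
    have hp' : q ^ (leg μ ⟨c, j + 1⟩ + 1) * t ^ (arm μ ⟨c, j + 1⟩) =
        squareParam μ q t j c / t := by
      rw [← hp, pow_succ t, ← mul_assoc, mul_div_cancel_right₀ _ ht]
    rw [hp, hp']
    change (if σ.row j c < σ.row (j + 1) c then _ else _) *
      (if σ.row (j + 1) c < σ.row j c then _ else _) = _
    rw [colWeight, if_neg hx]
    rcases lt_trichotomy (σ.row j c) (σ.row (j + 1) c) with h | h | h
    · rw [if_pos h, if_pos h, if_neg h.not_gt, mul_one]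
    · rw [h]
      simp
    · rw [if_neg h.not_gt, if_neg h.not_gt, if_pos h, if_pos h, one_mul, mul_div_assoc]
  · rw [if_neg hjc, colWeight, if_pos (σ.row_eq_top.2 (by omega))]

/-- The filling with given rows. -/
def ofRows (μ : Fin n → ℕ) {N : ℕ} (ρ : Fin N → Word n) : Filling μ :=
  ⟨fun c j => if h : 0 < (j : ℕ) ∧ (j : ℕ) ≤ N then (ρ ⟨j - 1, by omega⟩ c).untopD c else c,
    fun i => by simp⟩

theorem prod_rows_eq (σ : Filling μ) {q t : K} (ht : t ≠ 0) {N : ℕ} (hN : ∀ c, μ c ≤ N) :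
    (open Classical in if σ.NonAttacking then
      σ.xpow K * C (t ^ σ.delta *
            (∏ s ∈ σ.descents, (1 - t) / (1 - q ^ (leg μ s + 1) * t ^ (arm μ s + 1))) *
            (∏ s ∈ σ.ascents, (q ^ (leg μ s + 1) * t ^ arm μ s * (1 - t)) /
              (1 - q ^ (leg μ s + 1) * t ^ (arm μ s + 1)))) else 0) =
      ∏ j ∈ Finset.range N, (C (rowWeight t (squareParam μ q t j) (σ.row j) (σ.row (j + 1))) *
        wordMonomial K (σ.row (j + 1))) := by
  rw [Finset.prod_mul_distrib, ← map_prod, ← σ.xpow_eq hN]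
  by_cases hσ : σ.NonAttacking
  · rw [if_pos hσ]
    rw [σ.nonAttacking_iff hN] at hσ
    rw [mul_assoc, σ.prod_colWeight_eq ht hN, σ.delta_eq hN hσ, mul_comm]
    congr 2
    have hz : ∀ s : Finset ℕ, t ^ ∑ j ∈ s, rowDelta (σ.row j) (σ.row (j + 1)) =
        ∏ j ∈ s, t ^ rowDelta (σ.row j) (σ.row (j + 1)) := by
      intro s
      induction s using Finset.induction_on with
      | empty => simp
      | insert a s ha ih => rw [Finset.sum_insert ha, Finset.prod_insert ha, zpow_add₀ ht, ih]
    rw [hz, mul_comm, ← Finset.prod_mul_distrib]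
    refine Finset.prod_congr rfl fun j hj => ?_
    rw [rowWeight, if_pos (hσ j (Finset.mem_range.1 hj))]
  · rw [if_neg hσ]
    rw [σ.nonAttacking_iff hN] at hσ
    push Not at hσ
    obtain ⟨j, hj, hna⟩ := hσ
    rw [Finset.prod_eq_zero (Finset.mem_range.2 hj) (by rw [rowWeight, if_neg hna]), C_0, zero_mul]

theorem basementSum_id_eq {q t : K} (ht : t ≠ 0) {N : ℕ} (hN : ∀ c, μ c ≤ N) :
    basementSum q t μ N id = ∑ σ ∈ nonAttackingFillings μ,
        σ.xpow K * C (t ^ σ.delta *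
            (∏ s ∈ σ.descents, (1 - t) / (1 - q ^ (leg μ s + 1) * t ^ (arm μ s + 1))) *
            (∏ s ∈ σ.ascents, (q ^ (leg μ s + 1) * t ^ arm μ s * (1 - t)) /
              (1 - q ^ (leg μ s + 1) * t ^ (arm μ s + 1)))) := by
  classical
  rw [nonAttackingFillings, Finset.sum_filter, basementSum, fillSum_eq_sum]
  have hrow : ∀ ρ ∈ Fintype.piFinset (fun i : Fin N => aliveWords μ (0 + 1 + i)), ∀ i : Fin N,
      (ofRows μ ρ).row (i + 1) = ρ i := by
    intro ρ hρ i
    rw [Fintype.mem_piFinset] at hρ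
    funext c
    have h1 := mem_aliveWords.1 (hρ i) c
    by_cases h : (i : ℕ) + 1 ≤ μ c
    · rw [(ofRows μ ρ).row_of_le h]
      simp only [ofRows]
      rw [dif_pos (by simp)]
      have h2 : ρ i c ≠ ⊤ := by rw [Ne, h1]; omega
      obtain ⟨x, hx⟩ := WithTop.ne_top_iff_exists.1 h2
      simp only [Nat.add_sub_cancel, Fin.eta, ← hx, WithTop.untopD_coe]
    · rw [(ofRows μ ρ).row_eq_top.2 (by omega), h1.2 (by omega)]
  refine (Finset.sum_nbij' (fun σ (i : Fin N) => σ.row (i + 1)) (fun ρ => ofRows μ ρ)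
    ?_ ?_ ?_ ?_ ?_).symm
  · intro σ _
    rw [Fintype.mem_piFinset]
    intro i
    rw [mem_aliveWords]
    intro c
    rw [σ.row_eq_top]
    omega
  · exact fun ρ _ => Finset.mem_univ _
  · intro σ _
    refine Subtype.ext (funext fun c => funext fun j => ?_)
    simp only [ofRows]
    have hj := j.isLt
    have hc := hN c
    split_ifs with h
    · rw [σ.row_of_le (by omega), WithTop.untopD_coe]
      exact congrArg (σ.1 c) (Fin.ext (by change (j : ℕ) - 1 + 1 = j; omega))
    · have : j = 0 := Fin.ext (by change (j : ℕ) = 0; omega)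
      rw [this, σ.2]
  · intro ρ hρ
    funext i
    exact hrow ρ hρ i
  · intro σ _
    rw [prod_rows_eq σ ht hN, Finset.prod_range]
    refine Finset.prod_congr rfl fun i _ => ?_
    congr 3
    · rw [zero_add]
    · rcases i with ⟨i, hi⟩
      rcases i with _ | i
      · rw [σ.row_zero]
        rfl
      · rfl

end Fillings

section Coefficient

variable {K : Type*} [Field K] {n : ℕ} {μ : Fin n → ℕ}

/-- The number of occurrences of each letter in a filling, outside the basement. -/
def Filling.content (σ : Filling μ) : Fin n →₀ ℕ :=
  ∑ i : Fin n, ∑ j : Fin (μ i), Finsupp.single (σ.1 i j.succ) 1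

theorem Filling.xpow_eq_monomial (σ : Filling μ) : σ.xpow K = monomial σ.content 1 := by
  simp only [xpow, content, monomial_sum_one, X]

theorem Filling.content_apply (σ : Filling μ) (v : Fin n) :
    σ.content v = ∑ i : Fin n, ∑ j : Fin (μ i), if σ.1 i j.succ = v then 1 else 0 := by
  simp only [content, Finsupp.finsetSum_apply, Finsupp.single_apply]

theorem Filling.le_of_content_eq (σ : Filling μ)
    (hc : σ.content = Finsupp.equivFunOnFinite.symm μ) {j : ℕ}
    (ih : ∀ j' < j, ∀ c, j' ≤ μ c → σ.row j' c = c) {c v : Fin n} (hj : 0 < j) (hjc : j ≤ μ c)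
    (hv : σ.row j c = v) : j ≤ μ v := by
  by_contra! hlt
  have hcv : v ≠ c := by rintro rfl; omega
  have h1 : σ.content v = μ v := by rw [hc]; rfl
  rw [σ.content_apply] at h1
  have h2 : ∑ i ∈ {v, c}, ∑ j : Fin (μ i), (if σ.1 i j.succ = v then 1 else 0) ≤ μ v :=
    (Finset.sum_le_sum_of_subset (Finset.subset_univ _)).trans h1.le
  rw [Finset.sum_pair hcv] at h2
  have h3 : ∑ j : Fin (μ v), (if σ.1 v j.succ = v then 1 else 0) = μ v := by
    rw [Finset.sum_congr rfl (g := fun _ => 1)]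
    · simp
    · intro j' _
      have := ih (j' + 1) (by omega) v (by omega)
      rw [σ.row_of_le (by omega)] at this
      exact if_pos (WithTop.coe_inj.1 this)
  have h4 : 1 ≤ ∑ j : Fin (μ c), (if σ.1 c j.succ = v then 1 else 0) := by
    refine le_trans ?_ (Finset.single_le_sum (fun _ _ => Nat.zero_le _)
      (Finset.mem_univ (⟨j - 1, by omega⟩ : Fin (μ c))))
    rw [σ.row_of_le hjc, WithTop.coe_inj] at hv
    rw [if_pos]
    rw [← hv]
    exact congrArg (σ.1 c) (Fin.ext (by change j - 1 + 1 = j; omega))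
  omega

theorem Filling.row_eq_of_content_eq (σ : Filling μ) (hσ : σ.NonAttacking)
    (hc : σ.content = Finsupp.equivFunOnFinite.symm μ) (j : ℕ) :
    ∀ c, j ≤ μ c → σ.row j c = c := by
  induction j using Nat.strong_induction_on with
  | _ j ih =>
    rcases j with _ | j
    · intro c _
      rw [σ.row_zero]
      rfl
    intro c
    induction c using WellFoundedLT.induction with
    | _ c ihc =>
      intro hjc
      have hna : RowNA (σ.row j) (σ.row (j + 1)) :=
        (σ.nonAttacking_iff (N := ∑ c, μ c)
          (fun c => Finset.single_le_sum (fun _ _ => Nat.zero_le _) (Finset.mem_univ c))).1 hσ j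
          (Nat.lt_of_succ_le (hjc.trans
            (Finset.single_le_sum (fun _ _ => Nat.zero_le _) (Finset.mem_univ c))))
      have hv := σ.row_of_le hjc
      set v := σ.1 c ⟨j + 1, by omega⟩ with hv_def
      have hjv := σ.le_of_content_eq hc ih (Nat.succ_pos j) hjc hv
      have htop : σ.row (j + 1) c ≠ ⊤ := by rw [hv]; exact WithTop.coe_ne_top
      rw [hv]
      rcases lt_trichotomy v c with h | h | h
      · have h1 := ihc v h hjv
        exact ((hna v c h (by rw [h1]; exact WithTop.coe_ne_top)).1 (h1.trans hv.symm)).elim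
      · rw [h]
      · have h1 := ih j (Nat.lt_succ_self j) v (by omega)
        exact ((hna c v h htop).2 (hv.trans h1.symm)).elim

/-- The filling whose columns are constant. -/
def trivialFilling (μ : Fin n → ℕ) : Filling μ := ⟨fun i _ => i, fun _ => rfl⟩

theorem trivialFilling_row {j : ℕ} {c : Fin n} (h : j ≤ μ c) : (trivialFilling μ).row j c = c :=
  (trivialFilling μ).row_of_le h

theorem Filling.eq_trivialFilling (σ : Filling μ) (hσ : σ.NonAttacking)
    (hc : σ.content = Finsupp.equivFunOnFinite.symm μ) : σ = trivialFilling μ := by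
  refine Subtype.ext (funext fun c => funext fun j => ?_)
  have hj : (j : ℕ) ≤ μ c := by omega
  have h := σ.row_eq_of_content_eq hσ hc j c hj
  rw [σ.row_of_le hj] at h
  exact WithTop.coe_inj.1 h

theorem trivialFilling_content : (trivialFilling μ).content = Finsupp.equivFunOnFinite.symm μ := by
  ext v
  rw [Filling.content_apply, Finset.sum_eq_single v]
  · simp [trivialFilling]
  · intro i _ hi
    simp [trivialFilling, hi]
  · simp

theorem trivialFilling_rowNA (j : ℕ) :
    RowNA ((trivialFilling μ).row j) ((trivialFilling μ).row (j + 1)) := by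
  intro c d hcd hc
  have key : ∀ i, (trivialFilling μ).row (j + 1) c ≠ (trivialFilling μ).row i d := by
    intro i h
    have h1 := h ▸ hc
    rw [Ne, Filling.row_eq_top] at h1 hc
    rw [trivialFilling_row (by omega), trivialFilling_row (by omega)] at h
    exact hcd.ne (WithTop.coe_inj.1 h)
  exact ⟨key _, key _⟩

theorem trivialFilling_delta : (trivialFilling μ).delta = 0 := by
  rw [Filling.delta_eq _ (N := ∑ c, μ c)
    (fun c => Finset.single_le_sum (fun _ _ => Nat.zero_le _) (Finset.mem_univ c))
    (fun j _ => trivialFilling_rowNA j)]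
  refine Finset.sum_eq_zero fun j _ => Finset.sum_eq_zero fun c _ =>
    Finset.sum_eq_zero fun d _ => ?_
  split_ifs with hcd
  swap
  · rfl
  by_cases hc : (trivialFilling μ).row (j + 1) c = ⊤
  · simp [hc, ind]
  have key : ∀ i, (trivialFilling μ).row (j + 1) c < (trivialFilling μ).row i d := by
    intro i
    by_cases hd : (trivialFilling μ).row i d = ⊤
    · rw [hd]
      exact lt_top_iff_ne_top.2 hc
    · rw [Filling.row_eq_top] at hc hd
      rw [trivialFilling_row (by omega), trivialFilling_row (by omega)]
      exact WithTop.coe_lt_coe.2 hcd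
  simp [key, ind]

theorem trivialFilling_entry {s : Σ _ : Fin n, ℕ} (hs : s ∈ dg μ) :
    (trivialFilling μ).entry ⟨s.1, s.2 - 1⟩ = (trivialFilling μ).entry s := by
  simp only [dg, Finset.mem_sigma, Finset.mem_univ, true_and, Finset.mem_Icc] at hs
  change (trivialFilling μ).row (s.2 - 1) s.1 = (trivialFilling μ).row s.2 s.1
  rw [trivialFilling_row (by omega), trivialFilling_row (by omega)]

theorem trivialFilling_descents : (trivialFilling μ).descents = ∅ :=
  Finset.filter_eq_empty_iff.2 fun _ hs => by rw [trivialFilling_entry hs]; exact lt_irrefl _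

theorem trivialFilling_ascents : (trivialFilling μ).ascents = ∅ :=
  Finset.filter_eq_empty_iff.2 fun _ hs => by rw [trivialFilling_entry hs]; exact lt_irrefl _

theorem Filling.xpow_totalDegree_le (σ : Filling μ) :
    (σ.xpow K).totalDegree ≤ ∑ i, μ i := by
  refine (totalDegree_finsetProd _ _).trans (Finset.sum_le_sum fun i _ => ?_)
  refine (totalDegree_finsetProd _ _).trans ?_
  simp [totalDegree_X]

/-- The combinatorial formula for the nonsymmetric Macdonald polynomial. -/
def fillingPoly (q t : K) (μ : Fin n → ℕ) : MvPolynomial (Fin n) K :=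
  ∑ σ ∈ nonAttackingFillings μ, σ.xpow K * C (t ^ σ.delta *
    (∏ s ∈ σ.descents, (1 - t) / (1 - q ^ (leg μ s + 1) * t ^ (arm μ s + 1))) *
    (∏ s ∈ σ.ascents, (q ^ (leg μ s + 1) * t ^ arm μ s * (1 - t)) /
      (1 - q ^ (leg μ s + 1) * t ^ (arm μ s + 1))))

theorem isNonsymMacdonald_fillingPoly {q t : K} (hq : q ≠ 0) (ht : t ≠ 0)
    (hqt : ∀ a b : ℤ, q ^ a * t ^ b = 1 → a = 0 ∧ b = 0) (μ : Fin n → ℕ) :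
    IsNonsymMacdonald q t μ (fillingPoly q t μ) where
  totalDegree_le := by
    refine totalDegree_finsetSum_le fun σ _ => ?_
    refine (totalDegree_mul _ _).trans ?_
    rw [totalDegree_C, add_zero]
    exact σ.xpow_totalDegree_le
  coeff_eq_one := by
    classical
    rw [fillingPoly, coeff_sum, Finset.sum_eq_single (trivialFilling μ)]
    · rw [mul_comm, coeff_C_mul, Filling.xpow_eq_monomial, trivialFilling_content, coeff_monomial,
        trivialFilling_delta, trivialFilling_descents, trivialFilling_ascents]
      simp
    · intro σ hσ hne
      have hσ' : σ.NonAttacking := by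
        simpa [nonAttackingFillings] using hσ
      rw [mul_comm, coeff_C_mul, Filling.xpow_eq_monomial, coeff_monomial,
        if_neg fun h => hne (σ.eq_trivialFilling hσ' h), mul_zero]
    · intro h
      refine (h ?_).elim
      simp only [nonAttackingFillings, Finset.mem_filter, Finset.mem_univ, true_and]
      exact (Filling.nonAttacking_iff _ (N := ∑ c, μ c)
        (fun c => Finset.single_le_sum (fun _ _ => Nat.zero_le _) (Finset.mem_univ c))).2
        fun j _ => trivialFilling_rowNA j
  eigen := by
    intro i
    have hN : ∀ c, μ c ≤ ∑ c, μ c :=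
      fun c => Finset.single_le_sum (fun _ _ => Nat.zero_le _) (Finset.mem_univ c)
    rw [fillingPoly, ← basementSum_id_eq ht hN]
    exact cherednikY_basementSum hq ht hqt μ hN i

end Coefficient

section Uniqueness

theorem linearIndependent_of_joint_eigenvectors {K V ι κ : Type*} [Field K] [AddCommGroup V]
    [Module K V] (Y : ι → Module.End K V) (v : κ → V) (ev : κ → ι → K)
    (hev : Function.Injective ev) (hv : ∀ k, v k ≠ 0) (hY : ∀ k i, Y i (v k) = ev k i • v k) :
    LinearIndependent K v := by
  classical
  rw [linearIndependent_iff']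
  intro s
  induction s using Finset.induction_on with
  | empty => simp
  | insert a s ha ih =>
    intro g hg
    have hs : ∀ k ∈ s, g k = 0 := by
      intro k hk
      obtain ⟨i, hi⟩ := Function.ne_iff.1 (hev.ne (show k ≠ a by rintro rfl; exact ha hk))
      have h1 : ∑ k ∈ s, (g k * (ev k i - ev a i)) • v k = 0 := by
        have h2 : ∑ k ∈ insert a s, (g k * (ev k i - ev a i)) • v k = 0 := by
          have h3 := congrArg (fun x => Y i x - ev a i • x) hg
          simp only [map_sum, map_smul, hY, Finset.smul_sum, ← Finset.sum_sub_distrib, map_zero,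
            smul_zero, sub_zero] at h3
          rw [← h3]
          refine Finset.sum_congr rfl fun k _ => ?_
          module
        rw [Finset.sum_insert ha, sub_self, mul_zero, zero_smul, zero_add] at h2
        exact h2
      have h4 := ih _ h1 k hk
      exact (mul_eq_zero.1 h4).resolve_right (sub_ne_zero.2 hi)
    rw [Finset.sum_insert ha, Finset.sum_eq_zero fun k hk => by rw [hs k hk, zero_smul],
      add_zero] at hg
    intro k hk
    rcases Finset.mem_insert.1 hk with rfl | hk
    · exact (smul_eq_zero.1 hg).resolve_right (hv k)
    · exact hs k hk

variable {K : Type*} [Field K] {n : ℕ}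

theorem eigenvalueY_injective {q t : K} (hq : q ≠ 0) (ht : t ≠ 0)
    (hqt : ∀ a b : ℤ, q ^ a * t ^ b = 1 → a = 0 ∧ b = 0) :
    Function.Injective (eigenvalueY q t : (Fin n → ℕ) → Fin n → K) := by
  intro μ ν h
  funext i
  have h1 := congrFun h i
  unfold eigenvalueY at h1
  have h2 := (hqt (μ i - ν i) ((eta μ i + i) - (eta ν i + i)) (by
    rw [zpow_sub₀ hq, zpow_sub₀ ht, div_mul_div_comm, zpow_natCast, zpow_natCast, h1]
    exact div_self (mul_ne_zero (pow_ne_zero _ hq) (zpow_ne_zero _ ht)))).1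
  omega

theorem IsNonsymMacdonald.ne_zero {q t : K} {μ : Fin n → ℕ} {f : MvPolynomial (Fin n) K}
    (hf : IsNonsymMacdonald q t μ f) : f ≠ 0 := by
  rintro rfl
  simpa using hf.coeff_eq_one

/-- The exponents of total degree at most `d`. -/
abbrev DegLE (n d : ℕ) : Set (Fin n →₀ ℕ) := {s | (s.sum fun _ e => e) ≤ d}

theorem mem_degLE {n d : ℕ} {s : Fin n →₀ ℕ} : s ∈ DegLE n d ↔ ∑ i, s i ≤ d := by
  change (s.sum fun _ e => e) ≤ d ↔ _
  rw [Finsupp.sum_fintype _ _ fun _ => rfl]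

theorem degLE_finite (n d : ℕ) : (DegLE n d).Finite := by
  refine (Set.finite_Iic (Finsupp.equivFunOnFinite.symm fun _ : Fin n => d)).subset ?_
  intro s hs i
  rw [mem_degLE] at hs
  exact (Finset.single_le_sum (fun _ _ => Nat.zero_le _) (Finset.mem_univ i)).trans hs

theorem IsNonsymMacdonald.unique {q t : K} (hq : q ≠ 0) (ht : t ≠ 0)
    (hqt : ∀ a b : ℤ, q ^ a * t ^ b = 1 → a = 0 ∧ b = 0) {μ : Fin n → ℕ}
    {f : MvPolynomial (Fin n) K} (hf : IsNonsymMacdonald q t μ f) : f = fillingPoly q t μ := by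
  classical
  set d := ∑ i, μ i with hd
  have := (degLE_finite n d).to_subtype
  have := Fintype.ofFinite (DegLE n d)
  let v : DegLE n d → MvPolynomial (Fin n) K := fun s => fillingPoly q t s.1
  have hv : ∀ s, IsNonsymMacdonald q t s.1 (v s) := fun s =>
    isNonsymMacdonald_fillingPoly hq ht hqt s.1
  have hli : LinearIndependent K v :=
    linearIndependent_of_joint_eigenvectors (cherednikY q t) v (fun s => eigenvalueY q t s.1)
      (fun s s' h => Subtype.ext (DFunLike.coe_injective (eigenvalueY_injective hq ht hqt h)))
      (fun s => (hv s).ne_zero) fun s i => (hv s).eigen i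
  let b : Module.Basis (DegLE n d) K (restrictTotalDegree (Fin n) K d) :=
    basisRestrictSupport K (DegLE n d)
  have : Module.Finite K (restrictTotalDegree (Fin n) K d) := Module.Finite.of_basis b
  have hspan : Submodule.span K (Set.range v) = restrictTotalDegree (Fin n) K d := by
    refine Submodule.eq_of_le_of_finrank_eq ?_ ?_
    · rw [Submodule.span_le]
      rintro _ ⟨s, rfl⟩
      rw [SetLike.mem_coe, mem_restrictTotalDegree]
      exact (hv s).totalDegree_le.trans (mem_degLE.1 s.2)
    · rw [finrank_span_eq_card hli, Module.finrank_eq_card_basis b]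
  have hmem : f ∈ Submodule.span K (Set.range v) := by
    rw [hspan, mem_restrictTotalDegree]
    exact hf.totalDegree_le
  obtain ⟨c, hc⟩ := Submodule.mem_span_range_iff_exists_fun K |>.1 hmem
  let m : DegLE n d := ⟨Finsupp.equivFunOnFinite.symm μ, mem_degLE.2 le_rfl⟩
  have hzero : ∀ s, s ≠ m → c s = 0 := by
    intro s hs
    obtain ⟨i, hi⟩ := Function.ne_iff.1 ((eigenvalueY_injective hq ht hqt).ne
      (show (s.1 : Fin n → ℕ) ≠ μ from fun h => hs (Subtype.ext (DFunLike.coe_injective h))))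
    have h1 : ∑ s, (c s * (eigenvalueY q t s.1 i - eigenvalueY q t μ i)) • v s = 0 := by
      have h3 := hf.eigen i
      rw [← sub_eq_zero, ← hc] at h3
      simp only [map_sum, map_smul, (hv _).eigen, Finset.smul_sum,
        ← Finset.sum_sub_distrib] at h3
      rw [← h3]
      refine Finset.sum_congr rfl fun s _ => ?_
      module
    have h4 := linearIndependent_iff'.1 hli _ _ h1 s (Finset.mem_univ s)
    exact (mul_eq_zero.1 h4).resolve_right (sub_ne_zero.2 hi)
  rw [Finset.sum_eq_single m (fun s _ hs => by rw [hzero s hs, zero_smul])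
    (fun h => (h (Finset.mem_univ m)).elim)] at hc
  have h5 := hf.coeff_eq_one
  have h6 := (hv m).coeff_eq_one
  rw [← hc, coeff_smul, smul_eq_mul] at h5
  change (v m).coeff (Finsupp.equivFunOnFinite.symm μ) = 1 at h6
  rw [h6, mul_one] at h5
  rw [← hc, h5, one_smul]
  rfl

end Uniqueness

end NonsymMacdonald

end

theorem proposition5p1 {K : Type*} [Field K] (q t : K) (hq : q ≠ 0) (ht : t ≠ 0)
    (hqt : ∀ a b : ℤ, q ^ a * t ^ b = 1 → a = 0 ∧ b = 0)
    {n : ℕ} (μ : Fin n → ℕ) (f : MvPolynomial (Fin n) K) :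
    NonsymMacdonald.IsNonsymMacdonald q t μ f ↔
      f = ∑ σ ∈ NonsymMacdonald.nonAttackingFillings μ,
        σ.xpow K * MvPolynomial.C
          (t ^ σ.delta *
            (∏ s ∈ σ.descents, (1 - t) /
              (1 - q ^ (NonsymMacdonald.leg μ s + 1) * t ^ (NonsymMacdonald.arm μ s + 1))) *
            (∏ s ∈ σ.ascents, (q ^ (NonsymMacdonald.leg μ s + 1) *
                t ^ NonsymMacdonald.arm μ s * (1 - t)) /
              (1 - q ^ (NonsymMacdonald.leg μ s + 1) * t ^ (NonsymMacdonald.arm μ s + 1)))) := by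
  constructor
  · exact fun hf => hf.unique hq ht hqt
  · rintro rfl
    exact NonsymMacdonald.isNonsymMacdonald_fillingPoly hq ht hqt μ
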